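/- Let $H\in(1/2,1)$ and let $B_H=(B_H(t))_{t\in[0,1]}$ be a fractional Brownian motion over $[0,1]$ with Hurst index $H$ on a probability space $(\Omega,\mathcal A,\mathbb P)$, i.e. a centred Gaussian process with $\mathrm{Cov}(B_H(t),B_H(s))=\frac12\left(|t|^{2H}+|s|^{2H}-|t-s|^{2H}\right)$. **Definitions.** A *random measure* over $[0,1]$ is a $\sigma$-additive map $M:\mathcal B([0,1])\to L^2(\Omega,\mathcal A,\mathbb P)$ for which there is a real (signed) measure $C_M$ on $[0,1]^2$ with $C_M(A\times B)=\mathrm{Cov}(M(A),M(B))$ for all Borel $A,B$. A *Riemann system* of a Borel set $D\subset[0,1]$ is a sequence, indexed by $n\in\mathbb N$, of finite Borel partitions $(I^n_j)_{j\in J_n}$ of $D$ (empty parts allowed) with $|J_n|\nearrow\infty$ and $\max_j\mathrm{diam}(I_j^n)\to0$, together with tag points $x^n_j\in[0,1]$, where $x_j^n\in I^n_j$ whenever $I^n_j\neq\emptyset$. A *continuous-function-measure kernel* over a compact space $E$ is a map $K$ such that $K(x,\cdot)$ is a real measure on $E$ for every $x\in E$ and $K(\cdot,A)$ is continuous on $E$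 for every Borel $A$. A kernel $K$ over $[0,1]$ is *self-integrable* over $D$ if there is a unique $\ell\in\mathbb R$ such that $\sum_{j}K(x_j^n,I_j^n)\to\ell$ for every Riemann system of $D$; then $\int_DK(x,dx):=\ell$. Its *second-order kernel* is $K^{(2)}((x,y),\cdot)=K(y,\cdot)\otimes K(x,\cdot)$, and $K^{(2)}$ is *quasi-self-integrable* over $A\times B$ with quasi-self-integral $\ell$ if $\ell$ is the unique real number such that $\lim_{(n,m)\to\infty}\sum_j\sum_kK^{(2)}((a^n_j,b^m_k),A^n_j\times B^m_k)=\ell$ for all Riemann systems $(A^n_j,a^n_j)$ of $A$ and $(B^m_k,b^m_k)$ of $B$. The stochastic integral $\int_DZ\,dM$ of a process $Z$ is *uniquely defined* in $L^2$ if there is a unique $Y\in L^2(\Omega,\mathcal A,\mathbb P)$ with $\sum_jZ(x_j^n)M(I_j^n)\to Y$ in $L^2$ for every Riemann system of $D$; then $\int_DZ\,dM:=Y$. **Statement.** 1. There is a unique random measure $B_H'$ over $[0,1]$ with $B_H'(\{0\})=B_H'(\{1\})=0$ that is the distributional derivative of $B_H$ on $(0,1)$, i.e. $\int_{[0,1]}\varphi\,dB_H'=-\int_0^1\varphi'(t)B_H(t)\,dt$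 for all $\varphi\in C_c^\infty((0,1))$. (The left side is the stochastic integral of the deterministic process $\varphi$, uniquely defined in $L^2$.) It is centred, satisfies $B_H'([0,t])=B_H(t)$ a.s. for every $t\in[0,1]$, and its covariance measure is $C_{B_H'}(E)=H(2H-1)\int_E|u-v|^{2H-2}\,d(u,v)$ for every Borel $E\subset[0,1]^2$, the density being integrable. 2. The kernel $K(t,A)=\mathrm{Cov}(B_H(t),B_H'(A))$ is a non-negative continuous-function-measure kernel over $[0,1]$, given by $K(t,A)=H\int_A\left(u^{2H-1}+|t-u|^{2H-1}\mathrm{sgn}(t-u)\right)du$, and $K^{(2)}$ is a continuous-function-measure kernel over $[0,1]^2$. 3. $K$ is self-integrable over $[0,1]$ with $\int_{[0,1]}K(x,dx)=\frac12$. 4. $K^{(2)}$ is quasi-self-integrable over $[0,1]\times[0,1]$, with quasi-self-integral $$\frac12-H\,\mathbf B(2H,2H+1)-\frac{H}{2(4H-1)},$$ where $\mathbf B$ is the beta function. 5. For every Borel set $A\subset[0,1]$ the stochastic integral $\int_AB_H\,dB_H'$ is uniquely defined in $L^2$, and $A\mapsto\int_AB_H\,dB_H'$ is a random measure over $[0,1]$.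 -/

import Mathlib

open MeasureTheory ProbabilityTheory Filter Topology
open scoped ENNReal

namespace SelfIntegral

/-- A Riemann system of a set `D`: for every `n` a finite Borel partition `(part n j)_j` of `D` with
tag points, such that the number of parts increases to infinity and the mesh tends to `0`.
Parts may be empty (so that finite sets have Riemann systems as well); the tag of a nonempty part
lies in that part. -/
structure RiemannSystem {X : Type*} [PseudoEMetricSpace X] [MeasurableSpace X] (D : Set X) where
  card : ℕ → ℕ
  part : (n : ℕ) → Fin (card n) → Set X
  tag : (n : ℕ) → Fin (card n) → X
  card_mono : Monotone card
  card_tendsto : Tendsto card atTop atTop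
  measurableSet_part : ∀ n j, MeasurableSet (part n j)
  disjoint_part : ∀ n, Pairwise fun i j => Disjoint (part n i) (part n j)
  iUnion_part : ∀ n, ⋃ j, part n j = D
  mesh_tendsto : Tendsto (fun n => ⨆ j, Metric.ediam (part n j)) atTop (𝓝 0)
  tag_mem : ∀ n j, (part n j).Nonempty → tag n j ∈ part n j

section Kernels

/-- `K` is a continuous-function-measure kernel: `K x` is a real measure for every `x`, and
`x ↦ K x A` is continuous for every Borel set `A`.  (The spaces used here are compact, so that
every Borel set is bounded and a real measure is a signed measure.) -/
def IsCfmKernel {X Y : Type*} [TopologicalSpace X] [MeasurableSpace Y]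
    (K : X → SignedMeasure Y) : Prop :=
  ∀ A, MeasurableSet A → Continuous fun x => K x A

variable {X : Type*} [PseudoEMetricSpace X] [MeasurableSpace X]

/-- `ℓ` is the limit of the Riemann sums `∑ⱼ K (xⱼ, Iⱼ)` along every Riemann system of `D`. -/
def IsSelfIntegral (K : X → SignedMeasure X) (D : Set X) (ℓ : ℝ) : Prop :=
  ∀ R : RiemannSystem D,
    Tendsto (fun n => ∑ j, K (R.tag n j) (R.part n j)) atTop (𝓝 ℓ)

/-- `K` is self-integrable over `D`. -/
def SelfIntegrable (K : X → SignedMeasure X) (D : Set X) : Prop :=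
  ∃! ℓ : ℝ, IsSelfIntegral K D ℓ

/-- The second-order kernel `K⁽²⁾ ((x, y), ·) = K (y, ·) ⊗ K (x, ·)`. -/
noncomputable def secondOrderKernel {X Y : Type*} [MeasurableSpace Y] (K : X → SignedMeasure Y) :
    X × X → SignedMeasure (Y × Y) :=
  fun p => VectorMeasure.prod (K p.2) (K p.1) (ContinuousLinearMap.mul ℝ ℝ)

theorem secondOrderKernel_prod {X Y : Type*} [MeasurableSpace Y] (K : X → SignedMeasure Y)
    (x y : X) (A B : Set Y) : secondOrderKernel K (x, y) (A ×ˢ B) = K y A * K x B := by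
  have : IsFiniteMeasure (K y).variation := by
    rw [← SignedMeasure.totalVariation_eq_variation]
    unfold SignedMeasure.totalVariation
    infer_instance
  simp only [secondOrderKernel]
  rw [VectorMeasure.prod_apply]
  rfl

/-- `ℓ` is the double limit, as `(n, m) → ∞`, of `∑ⱼ ∑ₖ L ((aⱼ, bₖ), Aⱼ × Bₖ)` along every Riemann
system of `A` and every Riemann system of `B`. -/
def IsQuasiSelfIntegral (L : X × X → SignedMeasure (X × X)) (A B : Set X) (ℓ : ℝ) : Prop :=
  ∀ (R : RiemannSystem A) (S : RiemannSystem B),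
    Tendsto (fun q : ℕ × ℕ => ∑ j, ∑ k,
        L (R.tag q.1 j, S.tag q.2 k) (R.part q.1 j ×ˢ S.part q.2 k))
      (atTop ×ˢ atTop) (𝓝 ℓ)

/-- `L` is quasi-self-integrable over `A × B`. -/
def QuasiSelfIntegrable (L : X × X → SignedMeasure (X × X)) (A B : Set X) : Prop :=
  ∃! ℓ : ℝ, IsQuasiSelfIntegral L A B ℓ

end Kernels

section Probability

variable {Ω : Type*} [MeasurableSpace Ω]

/-- `C` is the covariance measure of the `L²(P)`-valued measure `M`. -/
def IsCovarianceMeasure {X : Type*} [MeasurableSpace X] (P : Measure Ω)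
    (M : VectorMeasure X (Lp ℝ 2 P)) (C : SignedMeasure (X × X)) : Prop :=
  ∀ A B, MeasurableSet A → MeasurableSet B → C (A ×ˢ B) = cov[M A, M B; P]

/-- A random measure: a σ-additive `L²(P)`-valued set function whose covariance structure is given
by a real measure on the product space. -/
def IsRandomMeasure {X : Type*} [MeasurableSpace X] (P : Measure Ω)
    (M : VectorMeasure X (Lp ℝ 2 P)) : Prop :=
  ∃ C : SignedMeasure (X × X), IsCovarianceMeasure P M C

theorem cov_eq_inner {P : Measure Ω} [IsProbabilityMeasure P] {Z : Ω → ℝ} (hZ : MemLp Z 2 P)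
    (Y : Lp ℝ 2 P) :
    cov[Z, Y; P] = inner ℝ ((hZ.sub (memLp_const (∫ ω, Z ω ∂P))).toLp _) Y := by
  have hY : MemLp Y 2 P := Lp.memLp Y
  rw [L2.inner_def, covariance_eq_sub hZ hY]
  have h1 : (fun ω => inner ℝ
      (((hZ.sub (memLp_const (∫ ω, Z ω ∂P))).toLp _ : Lp ℝ 2 P) ω) (Y ω))
      =ᵐ[P] fun ω => (Z * Y) ω - (∫ ω, Z ω ∂P) * Y ω := by
    filter_upwards [(hZ.sub (memLp_const (∫ ω, Z ω ∂P))).coeFn_toLp] with ω hω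
    rw [hω]
    simp [sub_mul, mul_comm]
  rw [integral_congr_ae h1, integral_sub (hZ.integrable_mul hY)
    ((hY.integrable (by norm_num)).const_mul _), integral_const_mul]

/-- The map `Y ↦ Cov(Z, Y)` on `L²(P)`. -/
noncomputable def covHom (P : Measure Ω) [IsProbabilityMeasure P] (Z : Ω → ℝ)
    (hZ : MemLp Z 2 P) : Lp ℝ 2 P →+ ℝ where
  toFun Y := cov[Z, Y; P]
  map_zero' := by rw [cov_eq_inner hZ, inner_zero_right]
  map_add' Y Y' := by simp only [cov_eq_inner hZ, inner_add_right]

theorem continuous_covHom (P : Measure Ω) [IsProbabilityMeasure P] (Z : Ω → ℝ)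
    (hZ : MemLp Z 2 P) : Continuous (covHom P Z hZ) := by
  have h : ⇑(covHom P Z hZ) =
      fun Y : Lp ℝ 2 P => inner ℝ ((hZ.sub (memLp_const (∫ ω, Z ω ∂P))).toLp _) Y :=
    funext fun Y => cov_eq_inner hZ Y
  rw [h]
  fun_prop

/-- The cross-covariance kernel `K (x, A) = Cov(Z x, M A)` of a second-order process `Z` and an
`L²(P)`-valued measure `M`. -/
noncomputable def crossCovKernel {X Y : Type*} [MeasurableSpace Y] (P : Measure Ω)
    [IsProbabilityMeasure P] (Z : X → Ω → ℝ) (hZ : ∀ x, MemLp (Z x) 2 P)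
    (M : VectorMeasure Y (Lp ℝ 2 P)) : X → SignedMeasure Y :=
  fun x => M.mapRange (covHom P (Z x) (hZ x)) (continuous_covHom P (Z x) (hZ x))

theorem crossCovKernel_apply {X Y : Type*} [MeasurableSpace Y] (P : Measure Ω)
    [IsProbabilityMeasure P] (Z : X → Ω → ℝ) (hZ : ∀ x, MemLp (Z x) 2 P)
    (M : VectorMeasure Y (Lp ℝ 2 P)) (x : X) (A : Set Y) :
    crossCovKernel P Z hZ M x A = cov[Z x, M A; P] := rfl

/-- The random variable `Y` is the limit in `L^p(P)` of the Riemann sums `∑ⱼ Z (xⱼ) M (Iⱼ)` along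
every Riemann system of `D`. -/
def IsStochIntegral {X : Type*} [PseudoEMetricSpace X] [MeasurableSpace X] (p : ℝ≥0∞)
    (P : Measure Ω) (Z : X → Ω → ℝ) (M : VectorMeasure X (Lp ℝ 2 P)) (D : Set X)
    (Y : Lp ℝ p P) : Prop :=
  ∀ R : RiemannSystem D,
    Tendsto (fun n => eLpNorm
      (fun ω => (∑ j, Z (R.tag n j) ω * (M (R.part n j) : Ω → ℝ) ω) - Y ω) p P) atTop (𝓝 0)

/-- The stochastic integral `∫_D Z dM` is uniquely defined in the sense of `L^p(P)`. -/
def StochIntegralUniquelyDefined {X : Type*} [PseudoEMetricSpace X] [MeasurableSpace X] (p : ℝ≥0∞)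
    (P : Measure Ω) (Z : X → Ω → ℝ) (M : VectorMeasure X (Lp ℝ 2 P)) (D : Set X) : Prop :=
  ∃! Y : Lp ℝ p P, IsStochIntegral p P Z M D Y

/-- `B` is a fractional Brownian motion over `[0,1]` with Hurst index `H`. -/
structure IsFractionalBrownianMotion (H : ℝ) (B : unitInterval → Ω → ℝ) (P : Measure Ω) :
    Prop where
  isGaussianProcess : IsGaussianProcess B P
  centred : ∀ t, ∫ ω, B t ω ∂P = 0
  cov_eq : ∀ t s, cov[B t, B s; P] =
    (|(t : ℝ)| ^ (2 * H) + |(s : ℝ)| ^ (2 * H) - |(t : ℝ) - s| ^ (2 * H)) / 2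

theorem IsFractionalBrownianMotion.memLp {H : ℝ} {B : unitInterval → Ω → ℝ} {P : Measure Ω}
    (hB : IsFractionalBrownianMotion H B P) (t : unitInterval) : MemLp (B t) 2 P :=
  (hB.isGaussianProcess.hasGaussianLaw_eval t).memLp_two

/-- On the open interval `(0,1)`, the `L²(P)`-valued measure `M` is the distributional derivative of
the second-order process `Z`: `∫ φ dM = - ∫ φ'(t) Z(t) dt` for all smooth `φ` with compact support
in `(0,1)`.  The left side is the integral of a deterministic continuous function, the right side
a Bochner integral in `L²(P)`. -/
def IsDistributionalDerivative (P : Measure Ω) (Z : unitInterval → Ω → ℝ)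
    (hZ : ∀ t, MemLp (Z t) 2 P) (M : VectorMeasure unitInterval (Lp ℝ 2 P)) : Prop :=
  ∀ φ : ℝ → ℝ, ContDiff ℝ ((⊤ : ℕ∞) : WithTop ℕ∞) φ → HasCompactSupport φ →
    tsupport φ ⊆ Set.Ioo 0 1 →
    IsStochIntegral 2 P (fun (t : unitInterval) _ => φ t) M Set.univ
      (-∫ t : unitInterval, deriv φ t • (hZ t).toLp (Z t))

/-- `M` is the derivative random measure of `Z` over `[0,1]`: a random measure which is the
distributional derivative of `Z` on `(0,1)` and does not charge the two endpoints. -/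
structure IsDerivativeRandomMeasure (P : Measure Ω) (Z : unitInterval → Ω → ℝ)
    (hZ : ∀ t, MemLp (Z t) 2 P) (M : VectorMeasure unitInterval (Lp ℝ 2 P)) : Prop where
  isRandomMeasure : IsRandomMeasure P M
  isDistributionalDerivative : IsDistributionalDerivative P Z hZ M
  zero_endpoint : M {0} = 0
  one_endpoint : M {1} = 0

end Probability

end SelfIntegral

namespace SelfIntegral

/-! Write `p = 2H - 1`. The covariance of `B` is a double primitive: integrating `k(u,v) =
H(2H-1)|u-v|^(2H-2)` over `v ∈ [0,t]` gives the continuous density `c(t,u)` of the cross-covariance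
kernel, and integrating `c(t,·)` over `[0,s]` gives `Cov(B(t), B(s))`. As `H > 1/2`, `k` is
integrable.

Existence. The integrals of `k(u,·)` are at most `2H`, so the Schur test bounds the quadratic form
of `k` on `L²([0,1])`. Hence `1_[0,t] ↦ B(t)` extends to a bounded operator `Λ`
(`exists_wienerIntegral`), and `B'(A) = Λ(1_A)` is σ-additive. Testing against `y ∈ L²(P)` and
passing to the adjoint of `Λ` reduces the distributional derivative property to an integration by
parts. Uniqueness. Tested against `y`, the difference of two candidates is a signed measure that
annihilates test functions on `(0,1)` and does not charge the endpoints, so it is zero.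

Kernels. A vector measure on `[0,1]` is determined by its values on the sets `[0,t]`, so `B'([0,t])
= B(t)` fixes all covariances involving `B'`. The kernel and its second-order kernel have jointly
continuous densities; by uniform continuity their tagged sums converge to integrals of these
densities over the diagonal (`tendsto_sum_setIntegral`), which are evaluated explicitly.

Stochastic integral. All variables lie in a Gaussian subspace, so Isserlis' formula expresses inner
products of Riemann sums through covariances. The double limit is the same for all pairs of Riemann
systems, and in a Hilbert space this forces a common limit (`exists_tendsto_of_tendsto_inner`). The
Gram matrix of the limits comes from a finite positive measure on the square, which yields
σ-additivity with no further work on Riemann sums (`exists_vectorMeasure_of_inner`). -/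

section

/-! ### Hilbert space valued measures from Gram measures -/

section HilbertMeasure

/-- A Hilbert space valued set function whose Gram matrix is given by a finite measure on the
product space is additive. -/
theorem add_of_inner_eq_measure {X E : Type*} [MeasurableSpace X] [NormedAddCommGroup E]
    [InnerProductSpace ℝ E] {N : Set X → E} {ρ : Measure (X × X)} [IsFiniteMeasure ρ]
    (h : ∀ A B, MeasurableSet A → MeasurableSet B → inner ℝ (N A) (N B) = ρ.real (A ×ˢ B))
    {A B : Set X} (hA : MeasurableSet A) (hB : MeasurableSet B) (hAB : Disjoint A B) :
    N (A ∪ B) = N A + N B := by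
  have hU := hA.union hB
  have hl : ∀ D, MeasurableSet D →
      ρ.real ((A ∪ B) ×ˢ D) = ρ.real (A ×ˢ D) + ρ.real (B ×ˢ D) := fun D hD => by
    rw [Set.union_prod, measureReal_union (Set.disjoint_prod.2 (Or.inl hAB)) (hB.prod hD)]
  have hr : ∀ D, MeasurableSet D →
      ρ.real (D ×ˢ (A ∪ B)) = ρ.real (D ×ˢ A) + ρ.real (D ×ˢ B) := fun D hD => by
    rw [Set.prod_union, measureReal_union (Set.disjoint_prod.2 (Or.inr hAB)) (hD.prod hB)]
  -- The squared norm of `N (A ∪ B) - N A - N B` expands into nine Gram entries, which cancel by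
  -- additivity of `ρ` in each factor.
  rw [← sub_eq_zero, ← inner_self_eq_zero (𝕜 := ℝ)]
  simp only [inner_sub_left, inner_sub_right, inner_add_left, inner_add_right]
  rw [h _ _ hU hU, h _ _ hU hA, h _ _ hU hB, h _ _ hA hU, h _ _ hB hU, h _ _ hA hA,
    h _ _ hA hB, h _ _ hB hA, h _ _ hB hB, hl _ hU, hr _ hA, hr _ hB, hl _ hA, hl _ hB]
  ring

/-- The tail of a disjoint union has squared norm `ρ (T ×ˢ T)`, with `T` the part not yet exhausted.
Positivity of `ρ` bounds this by the first marginal of `T`, which tends to zero because the marginal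
is a finite measure. -/
theorem exists_vectorMeasure_of_inner {X E : Type*} [MeasurableSpace X] [NormedAddCommGroup E]
    [InnerProductSpace ℝ E] {N : Set X → E} {ρ : Measure (X × X)} [IsFiniteMeasure ρ]
    (h : ∀ A B, MeasurableSet A → MeasurableSet B → inner ℝ (N A) (N B) = ρ.real (A ×ˢ B)) :
    ∃ V : VectorMeasure X E, ∀ A, MeasurableSet A → V A = N A := by
  classical
  have h0 : N ∅ = 0 := by
    rw [← inner_self_eq_zero (𝕜 := ℝ), h _ _ .empty .empty]
    simp
  have hfin : ∀ f : ℕ → Set X, (∀ i, MeasurableSet (f i)) → Pairwise (Function.onFun Disjoint f) →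
      ∀ s : Finset ℕ, N (⋃ i ∈ s, f i) = ∑ i ∈ s, N (f i) := by
    intro f hf hd s
    induction s using Finset.induction_on with
    | empty => simp [h0]
    | insert a s ha ih =>
      rw [Finset.set_biUnion_insert, Finset.sum_insert ha,
        add_of_inner_eq_measure h (hf a) (Finset.measurableSet_biUnion _ fun i _ => hf i), ih]
      rw [Set.disjoint_iUnion₂_right]
      intro i hi
      exact hd (fun hai => ha (hai ▸ hi))
  refine ⟨⟨fun A => if MeasurableSet A then N A else 0, by simp [h0], fun A hA => by simp [hA],
    fun f hf hd => ?_⟩, fun A hA => by simp [hA]⟩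
  simp only [hf, MeasurableSet.iUnion hf, if_true]
  set U := ⋃ i, f i with hU
  have hUm : MeasurableSet U := MeasurableSet.iUnion hf
  have hrest : ∀ s : Finset ℕ, N U - ∑ i ∈ s, N (f i) = N (U \ ⋃ i ∈ s, f i) := by
    intro s
    have hm : MeasurableSet (⋃ i ∈ s, f i) := Finset.measurableSet_biUnion _ fun i _ => hf i
    have := add_of_inner_eq_measure h hm (hUm.diff hm) Set.disjoint_sdiff_right
    rw [Set.union_sdiff_cancel (Set.iUnion₂_subset fun i _ => Set.subset_iUnion f i)] at this
    rw [this, hfin f hf hd s]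
    abel
  have hbound : ∀ s : Finset ℕ, ‖N U - ∑ i ∈ s, N (f i)‖ ^ 2 ≤
      ρ.fst.real U - ∑ i ∈ s, ρ.fst.real (f i) := by
    intro s
    have hm : MeasurableSet (⋃ i ∈ s, f i) := Finset.measurableSet_biUnion _ fun i _ => hf i
    rw [hrest, ← real_inner_self_eq_norm_sq, h _ _ (hUm.diff hm) (hUm.diff hm),
      ← measureReal_biUnion_finset (fun i _ j _ hij => hd hij) (fun i _ => hf i),
      ← measureReal_sdiff (Set.iUnion₂_subset fun i _ => Set.subset_iUnion f i) hm,
      measureReal_def, measureReal_def, Measure.fst_apply (hUm.diff hm)]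
    exact ENNReal.toReal_mono (measure_ne_top _ _) (measure_mono fun x hx => hx.1)
  have hsum : HasSum (fun i => ρ.fst.real (f i)) (ρ.fst.real U) := by
    have := ρ.fst.toSignedMeasure.m_iUnion hf hd
    simpa [Measure.toSignedMeasure_apply, hf, MeasurableSet.iUnion hf] using this
  have ht : Tendsto (fun s : Finset ℕ => ‖N U - ∑ i ∈ s, N (f i)‖ ^ 2) atTop (𝓝 0) := by
    refine squeeze_zero (fun s => by positivity) hbound ?_
    have h2 : Tendsto (fun s : Finset ℕ => ∑ i ∈ s, ρ.fst.real (f i)) atTop (𝓝 (ρ.fst.real U)) :=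
      hsum
    simpa using h2.const_sub (ρ.fst.real U)
  have ht' : Tendsto (fun s : Finset ℕ => ‖N U - ∑ i ∈ s, N (f i)‖) atTop (𝓝 0) := by
    simpa using ht.sqrt
  rw [HasSum, SummationFilter.unconditional_filter]
  refine tendsto_iff_norm_sub_tendsto_zero.2 ?_
  simpa only [norm_sub_rev] using ht'

end HilbertMeasure

/-- A vector measure on `[0,1]` is determined by its distribution function. -/
theorem vectorMeasure_ext_Icc {E : Type*} [AddCommGroup E] [TopologicalSpace E] [T2Space E]
    [IsTopologicalAddGroup E] {μ ν : VectorMeasure unitInterval E}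
    (h : ∀ t, μ (Set.Icc 0 t) = ν (Set.Icc 0 t)) : μ = ν := by
  have hI : ∀ t : unitInterval, Set.Icc 0 t = Set.Iic t := fun t => by
    ext x; simp
  refine VectorMeasure.ext_of_generateFrom (Set.range Set.Iic) ?_ ?_ isPiSystem_Iic ?_
  · rintro _ ⟨t, rfl⟩
    rw [← hI, h]
  · rw [← borel_eq_generateFrom_Iic]
    exact BorelSpace.measurable_eq
  · have : (Set.univ : Set unitInterval) = Set.Icc 0 1 := by
      ext x; simpa using unitInterval.le_one' (t := x)
    rw [this, h]

/-! ### Riemann sums and Riemann systems -/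

section Riemann

/-- Convergence of generalized Riemann sums `∑ⱼ ∫_{Pⱼ} G(tⱼ, y) ρ(dy)`. -/
theorem tendsto_sum_setIntegral {Y ι : Type*} [PseudoMetricSpace Y] [CompactSpace Y]
    [MeasurableSpace Y] [BorelSpace Y] {l : Filter ι} {J : ι → Type*}
    [∀ i, Fintype (J i)] {S : ∀ i, J i → Set Y} {t : ∀ i, J i → Y} {D : Set Y}
    (hS : ∀ i j, MeasurableSet (S i j)) (hd : ∀ i, Pairwise fun j k => Disjoint (S i j) (S i k))
    (hU : ∀ i, ⋃ j, S i j = D)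
    (hmesh : ∀ δ > 0, ∀ᶠ i in l, ∀ j, ∀ y ∈ S i j, dist y (t i j) < δ)
    (ρ : Measure Y) [IsFiniteMeasure ρ] {G : Y × Y → ℝ} (hG : Continuous G) :
    Tendsto (fun i => ∑ j, ∫ y in S i j, G (t i j, y) ∂ρ) l (𝓝 (∫ y in D, G (y, y) ∂ρ)) := by
  have hint : ∀ g : Y → ℝ, Continuous g → Integrable g ρ := fun g hg =>
    hg.integrable_of_hasCompactSupport (HasCompactSupport.of_compactSpace g)
  have h1 : ∀ s, Continuous fun y => G (s, y) := fun s => hG.comp (by fun_prop)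
  have h2 : Continuous fun y => G (y, y) := hG.comp (by fun_prop)
  rw [Metric.tendsto_nhds]
  intro ε hε
  have huc := Metric.uniformContinuous_iff.1 (CompactSpace.uniformContinuous_of_continuous hG)
  -- Moving the tag to the point `y` changes `G` by less than `c`, so the total error is at most `c
  -- * ρ(D)`. The `+ 1` gives a strict inequality and covers `ρ(D) = 0`.
  set c := ε / (ρ.real D + 1) with hc
  have hcpos : 0 < c := by positivity
  obtain ⟨δ, hδ, hδ'⟩ := huc c hcpos
  filter_upwards [hmesh δ hδ] with i hi
  rw [← hU i, integral_iUnion_fintype (hS i) (hd i) fun j => (hint _ h2).integrableOn,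
    Real.dist_eq, ← Finset.sum_sub_distrib]
  have hle : ∀ j, |∫ y in S i j, G (t i j, y) ∂ρ - ∫ y in S i j, G (y, y) ∂ρ| ≤
      c * ρ.real (S i j) := by
    intro j
    rw [← integral_sub (hint _ (h1 _)).integrableOn (hint _ h2).integrableOn, ← Real.norm_eq_abs]
    refine norm_setIntegral_le_of_norm_le_const (measure_lt_top ρ _) fun y hy => ?_
    have := hδ' (a := (t i j, y)) (b := (y, y)) (by
      rw [Prod.dist_eq]
      simpa [dist_comm, hδ] using hi j y hy)
    exact this.le
  calc |∑ j, (∫ y in S i j, G (t i j, y) ∂ρ - ∫ y in S i j, G (y, y) ∂ρ)|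
      ≤ ∑ j, c * ρ.real (S i j) :=
        (Finset.abs_sum_le_sum_abs _ _).trans (Finset.sum_le_sum fun j _ => hle j)
    _ = c * ρ.real D := by
        rw [← Finset.mul_sum, ← hU i, measureReal_def, measure_iUnion (hd i) (hS i), tsum_fintype,
          ENNReal.toReal_sum (fun j _ => measure_ne_top _ _)]
        rfl
    _ < ε := by
        rw [hc, div_mul_eq_mul_div, div_lt_iff₀ (by positivity)]
        nlinarith [measureReal_nonneg (μ := ρ) (s := D)]

variable {X : Type*} [PseudoMetricSpace X] [MeasurableSpace X]

theorem RiemannSystem.eventually_dist_lt {D : Set X} (R : RiemannSystem D) {δ : ℝ} (hδ : 0 < δ) :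
    ∀ᶠ n in atTop, ∀ j, ∀ y ∈ R.part n j, dist y (R.tag n j) < δ := by
  have h := R.mesh_tendsto.eventually_lt_const (ENNReal.ofReal_pos.2 hδ)
  filter_upwards [h] with n hn j y hy
  have h1 : edist y (R.tag n j) < ENNReal.ofReal δ :=
    lt_of_le_of_lt ((Metric.edist_le_ediam_of_mem hy (R.tag_mem n j ⟨y, hy⟩)).trans
      (le_iSup (fun j => Metric.ediam (R.part n j)) j)) hn
  rwa [edist_dist, ENNReal.ofReal_lt_ofReal_iff hδ] at h1

theorem RiemannSystem.tendsto_sum_setIntegral [CompactSpace X] [BorelSpace X] {D : Set X}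
    (R : RiemannSystem D) (ρ : Measure X) [IsFiniteMeasure ρ] {G : X × X → ℝ} (hG : Continuous G) :
    Tendsto (fun n => ∑ j, ∫ y in R.part n j, G (R.tag n j, y) ∂ρ) atTop
      (𝓝 (∫ y in D, G (y, y) ∂ρ)) :=
  SelfIntegral.tendsto_sum_setIntegral R.measurableSet_part R.disjoint_part R.iUnion_part
    (fun _ hδ => R.eventually_dist_lt hδ) ρ hG

/-- The rectangles formed from two partitions partition `A ×ˢ B`, and in the sup metric their mesh
is controlled by both meshes. So this is the one-system statement on `X × X`, indexed by `ℕ × ℕ`. -/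
theorem RiemannSystem.tendsto_sum_sum_setIntegral [CompactSpace X] [SecondCountableTopology X]
    [BorelSpace X] {A B : Set X}
    (R : RiemannSystem A) (S : RiemannSystem B) (ρ : Measure (X × X)) [IsFiniteMeasure ρ]
    {G : (X × X) × (X × X) → ℝ} (hG : Continuous G) :
    Tendsto (fun q : ℕ × ℕ => ∑ j, ∑ k, ∫ y in R.part q.1 j ×ˢ S.part q.2 k,
      G ((R.tag q.1 j, S.tag q.2 k), y) ∂ρ) (atTop ×ˢ atTop) (𝓝 (∫ y in A ×ˢ B, G (y, y) ∂ρ)) := by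
  have := SelfIntegral.tendsto_sum_setIntegral (l := atTop ×ˢ atTop) (ι := ℕ × ℕ)
    (J := fun q => Fin (R.card q.1) × Fin (S.card q.2))
    (S := fun q j => R.part q.1 j.1 ×ˢ S.part q.2 j.2)
    (t := fun q j => (R.tag q.1 j.1, S.tag q.2 j.2)) (D := A ×ˢ B)
    (fun q j => (R.measurableSet_part _ _).prod (S.measurableSet_part _ _)) ?_ ?_ ?_ ρ hG
  · simpa only [Fintype.sum_prod_type] using this
  · intro q j k hjk
    rw [Set.disjoint_prod]
    by_cases h1 : j.1 = k.1
    · exact Or.inr (S.disjoint_part _ fun h2 => hjk (Prod.ext h1 h2))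
    · exact Or.inl (R.disjoint_part _ h1)
  · intro q
    ext y
    have h1 : y.1 ∈ A ↔ ∃ j, y.1 ∈ R.part q.1 j := by
      rw [← Set.mem_iUnion, R.iUnion_part]
    have h2 : y.2 ∈ B ↔ ∃ j, y.2 ∈ S.part q.2 j := by
      rw [← Set.mem_iUnion, S.iUnion_part]
    simp only [Set.mem_iUnion, Set.mem_prod, h1, h2, Prod.exists, exists_and_left,
      exists_and_right]
  · intro δ hδ
    filter_upwards [(R.eventually_dist_lt hδ).prod_mk (S.eventually_dist_lt hδ)] with q hq j y hy
    rw [Prod.dist_eq]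
    exact max_lt (hq.1 _ _ hy.1) (hq.2 _ _ hy.2)

end Riemann

/-- Every Borel set of `[0,1]` has a Riemann system. -/
theorem nonempty_riemannSystem {D : Set unitInterval} (hD : MeasurableSet D) :
    Nonempty (RiemannSystem D) := by
  classical
  -- Cells of length `1 / (n + 1)`; the point `1` has floor `n + 1`, so `n + 2` cells are needed.
  -- Empty cells receive the default tag `0`.
  let S : (n : ℕ) → Fin (n + 2) → Set unitInterval := fun n j =>
    D ∩ {x | ⌊(x : ℝ) * (n + 1)⌋₊ = j}
  refine ⟨⟨fun n => n + 2, S, fun n j => if h : (S n j).Nonempty then h.some else 0,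
    fun a b hab => by simpa using hab, tendsto_add_atTop_nat 2, fun n j => hD.inter ?_, ?_, ?_, ?_,
    fun n j h => by simpa [h] using h.some_mem⟩⟩
  · have hm : Measurable fun x : unitInterval => ⌊(x : ℝ) * (n + 1)⌋₊ :=
      Nat.measurable_floor.comp (by fun_prop)
    exact hm (measurableSet_singleton _)
  · intro n j k hjk
    rw [Set.disjoint_left]
    rintro x ⟨-, h1⟩ ⟨-, h2⟩
    exact hjk (Fin.ext (h1.symm.trans h2))
  · intro n
    ext x
    simp only [S, Set.mem_iUnion, Set.mem_inter_iff, Set.mem_ofPred_eq]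
    refine ⟨fun ⟨_, h, _⟩ => h, fun h => ⟨⟨⌊(x : ℝ) * (n + 1)⌋₊, ?_⟩, h, rfl⟩⟩
    have : (x : ℝ) * (n + 1) ≤ n + 1 := mul_le_of_le_one_left (by positivity) x.2.2
    calc ⌊(x : ℝ) * (n + 1)⌋₊ ≤ ⌊((n + 1 : ℕ) : ℝ)⌋₊ := Nat.floor_mono (by push_cast; exact this)
      _ = n + 1 := Nat.floor_natCast _
      _ < n + 2 := by omega
  · have hb : ∀ n, (⨆ j, Metric.ediam (S n j)) ≤ ENNReal.ofReal (1 / ((n : ℝ) + 1)) := by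
      intro n
      refine iSup_le fun j => Metric.ediam_le fun x hx y hy => ?_
      rw [edist_dist]
      refine ENNReal.ofReal_le_ofReal ?_
      have hn : (0 : ℝ) < n + 1 := by positivity
      have hx1 := Nat.floor_le (mul_nonneg x.2.1 hn.le)
      have hx2 := Nat.lt_floor_add_one ((x : ℝ) * (n + 1))
      have hy1 := Nat.floor_le (mul_nonneg y.2.1 hn.le)
      have hy2 := Nat.lt_floor_add_one ((y : ℝ) * (n + 1))
      rw [hx.2] at hx1 hx2
      rw [hy.2] at hy1 hy2
      rw [Subtype.dist_eq, Real.dist_eq, le_div_iff₀ hn, ← abs_of_pos hn, ← abs_mul, abs_le]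
      constructor <;> linarith [sub_mul (x : ℝ) y (n + 1)]
    refine tendsto_of_tendsto_of_tendsto_of_le_of_le tendsto_const_nhds ?_ (fun _ => zero_le) hb
    rw [← ENNReal.ofReal_zero]
    exact ENNReal.tendsto_ofReal tendsto_one_div_add_atTop_nhds_zero_nat

end

section

/-! ### Calculus of the signed power -/

section SignedPower

/-- The signed power `|x| ^ p * sgn x`. -/
noncomputable def signedRpow (p x : ℝ) : ℝ := |x| ^ p * Real.sign x

/-- Splitting into positive and negative parts removes the sign function, so that continuity and
inequalities follow from those of `rpow`. -/
theorem signedRpow_eq_max {p : ℝ} (hp : 0 < p) (x : ℝ) :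
    signedRpow p x = max x 0 ^ p - max (-x) 0 ^ p := by
  rcases lt_trichotomy x 0 with h | h | h
  · simp [signedRpow, abs_of_neg h, Real.sign_of_neg h, max_eq_right h.le, max_eq_left
      (neg_pos.2 h).le, Real.zero_rpow hp.ne']
  · simp [signedRpow, h]
  · simp [signedRpow, abs_of_pos h, Real.sign_of_pos h, max_eq_left h.le, max_eq_right
      (neg_neg_of_pos h).le, Real.zero_rpow hp.ne']

theorem continuous_signedRpow {p : ℝ} (hp : 0 < p) : Continuous (signedRpow p) := by
  rw [show signedRpow p = fun x => max x 0 ^ p - max (-x) 0 ^ p from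
    funext (signedRpow_eq_max hp)]
  exact ((continuous_id.max continuous_const).rpow_const fun _ => Or.inr hp.le).sub
    ((continuous_neg.max continuous_const).rpow_const fun _ => Or.inr hp.le)

theorem signedRpow_of_nonneg {p x : ℝ} (hp : 0 < p) (hx : 0 ≤ x) : signedRpow p x = x ^ p := by
  rw [signedRpow_eq_max hp, max_eq_left hx, max_eq_right (neg_nonpos.2 hx), Real.zero_rpow hp.ne',
    sub_zero]

theorem signedRpow_neg {p : ℝ} (hp : 0 < p) (x : ℝ) : signedRpow p (-x) = -signedRpow p x := by
  rw [signedRpow_eq_max hp, signedRpow_eq_max hp, neg_neg]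
  ring

theorem hasDerivAt_signedRpow (p : ℝ) {x : ℝ} (hx : x ≠ 0) :
    HasDerivAt (signedRpow p) (p * |x| ^ (p - 1)) x := by
  rcases lt_or_gt_of_ne hx with h | h
  · have h1 : HasDerivAt (fun y : ℝ => -((-y) ^ p)) (-(-1 * p * (-x) ^ (p - 1))) x :=
      ((hasDerivAt_neg x).rpow_const (Or.inl (by linarith))).neg
    refine (h1.congr_deriv (by rw [abs_of_neg h]; ring)).congr_of_eventuallyEq ?_
    filter_upwards [Iio_mem_nhds h] with y (hy : y < 0)
    simp [signedRpow, abs_of_neg hy, Real.sign_of_neg hy]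
  · refine ((Real.hasDerivAt_rpow_const (p := p) (Or.inl hx)).congr_deriv
      (by rw [abs_of_pos h])).congr_of_eventuallyEq ?_
    filter_upwards [Ioi_mem_nhds h] with y (hy : 0 < y)
    simp [signedRpow, abs_of_pos hy, Real.sign_of_pos hy]

theorem hasDerivAt_abs_rpow (r : ℝ) {x : ℝ} (hx : x ≠ 0) :
    HasDerivAt (fun y : ℝ => |y| ^ r) (r * signedRpow (r - 1) x) x := by
  rcases lt_or_gt_of_ne hx with h | h
  · have h1 : HasDerivAt (fun y : ℝ => (-y) ^ r) (-1 * r * (-x) ^ (r - 1)) x :=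
      (hasDerivAt_neg x).rpow_const (Or.inl (by linarith))
    refine (h1.congr_deriv ?_).congr_of_eventuallyEq ?_
    · rw [signedRpow, abs_of_neg h, Real.sign_of_neg h]; ring
    filter_upwards [Iio_mem_nhds h] with y (hy : y < 0)
    simp [abs_of_neg hy]
  · refine ((Real.hasDerivAt_rpow_const (p := r) (Or.inl hx)).congr_deriv
      (by rw [signedRpow, abs_of_pos h, Real.sign_of_pos h, mul_one])).congr_of_eventuallyEq ?_
    filter_upwards [Ioi_mem_nhds h] with y (hy : 0 < y)
    simp [abs_of_pos hy]

theorem intervalIntegrable_abs_rpow {p : ℝ} (hp : 0 < p) (a b : ℝ) :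
    IntervalIntegrable (fun v : ℝ => |v| ^ (p - 1)) volume a b := by
  have h0 : ∀ c : ℝ, 0 ≤ c → IntervalIntegrable (fun v : ℝ => |v| ^ (p - 1)) volume 0 c := by
    intro c hc
    refine (intervalIntegral.intervalIntegrable_rpow' (a := 0) (b := c) (r := p - 1)
      (by linarith)).congr fun x hx => ?_
    rw [Set.uIoc_of_le hc] at hx
    simp [abs_of_pos hx.1]
  have h1 : ∀ c : ℝ, IntervalIntegrable (fun v : ℝ => |v| ^ (p - 1)) volume 0 c := by
    intro c
    rcases le_total 0 c with hc | hc
    · exact h0 c hc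
    · have := (h0 (-c) (by linarith)).comp_sub_left 0
      simpa using this
  exact (h1 a).symm.trans (h1 b)

/-- The primitive `signedRpow p / p` is continuous across the singularity and differentiable away
from it, so the fundamental theorem of calculus with a countable exceptional set applies. -/
theorem integral_abs_rpow_sub {p : ℝ} (hp : 0 < p) (u a b : ℝ) :
    ∫ v in a..b, |v - u| ^ (p - 1) = (signedRpow p (b - u) - signedRpow p (a - u)) / p := by
  rw [intervalIntegral.integral_comp_sub_right (fun v => |v| ^ (p - 1)) u]
  have h := MeasureTheory.integral_eq_of_hasDerivAt_off_countable
    (a := a - u) (b := b - u) (signedRpow p) (fun v => p * |v| ^ (p - 1)) (s := {0})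
    (Set.countable_singleton _) (continuous_signedRpow hp).continuousOn
    (fun x hx => hasDerivAt_signedRpow p (by simpa using hx.2))
    ((intervalIntegrable_abs_rpow hp _ _).const_mul p)
  rw [intervalIntegral.integral_const_mul] at h
  rw [← h]
  field_simp

theorem integral_signedRpow_sub {p : ℝ} (hp : 0 < p) (u a b : ℝ) :
    ∫ v in a..b, signedRpow p (v - u) =
      (|b - u| ^ (p + 1) - |a - u| ^ (p + 1)) / (p + 1) := by
  rw [intervalIntegral.integral_comp_sub_right (fun v => signedRpow p v) u]
  have h := MeasureTheory.integral_eq_of_hasDerivAt_off_countable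
    (a := a - u) (b := b - u) (fun v => |v| ^ (p + 1)) (fun v => (p + 1) * signedRpow p v)
    (s := {0}) (Set.countable_singleton _)
    (continuous_abs.rpow_const fun _ => Or.inr (by linarith)).continuousOn
    (fun x hx => by simpa using hasDerivAt_abs_rpow (p + 1) (by simpa using hx.2))
    (((continuous_signedRpow hp).intervalIntegrable _ _).const_mul (p + 1))
  rw [intervalIntegral.integral_const_mul] at h
  rw [← h]
  field_simp

end SignedPower

/-! ### Integrals over the subtype `unitInterval` as interval integrals -/

section UnitInterval

theorem setIntegral_Icc_unitInterval (f : ℝ → ℝ) (t : unitInterval) :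
    ∫ u in Set.Icc 0 t, f u = ∫ u in (0 : ℝ)..t, f u := by
  have h := unitInterval.measurePreserving_coe.setIntegral_preimage_emb
    unitInterval.measurableEmbedding_coe f (Set.Icc 0 (t : ℝ))
  have hpre : ((↑) : unitInterval → ℝ) ⁻¹' Set.Icc 0 (t : ℝ) = Set.Icc 0 t := by
    ext x
    simp only [Set.mem_preimage, Set.mem_Icc, ← Subtype.coe_le_coe]
    rfl
  rw [hpre, Measure.restrict_restrict measurableSet_Icc, Set.inter_eq_left.2] at h
  · rw [h, intervalIntegral.integral_of_le t.2.1, integral_Icc_eq_integral_Ioc]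
  · exact Set.Icc_subset_Icc le_rfl t.2.2

theorem integral_unitInterval (f : ℝ → ℝ) :
    ∫ u : unitInterval, f u = ∫ u in (0 : ℝ)..1, f u := by
  have h := setIntegral_Icc_unitInterval f 1
  have : (Set.Icc 0 1 : Set unitInterval) = Set.univ := by
    ext x; simpa using unitInterval.le_one' (t := x)
  simpa [this] using h

theorem integrable_unitInterval {f : ℝ → ℝ} (hf : IntervalIntegrable f volume 0 1) :
    Integrable fun u : unitInterval => f u := by
  have h := unitInterval.measurePreserving_coe.integrable_comp_emb
    unitInterval.measurableEmbedding_coe (g := f)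
  refine h.2 ?_
  rw [intervalIntegrable_iff_integrableOn_Icc_of_le zero_le_one] at hf
  exact hf

end UnitInterval

/-! ### The covariance density and its two primitives -/

section CovarianceKernel

/-- The density `H (2H - 1) |u - v| ^ (2H - 2)` of the covariance measure. -/
noncomputable def covDensity (H : ℝ) (q : unitInterval × unitInterval) : ℝ :=
  H * (2 * H - 1) * |(q.1 : ℝ) - q.2| ^ (2 * H - 2)

/-- The density of the cross-covariance kernel. -/
noncomputable def crossDensity (H : ℝ) (q : unitInterval × unitInterval) : ℝ :=
  H * ((q.2 : ℝ) ^ (2 * H - 1) + |(q.1 : ℝ) - q.2| ^ (2 * H - 1) * Real.sign ((q.1 : ℝ) - q.2))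

/-- The covariance function of fractional Brownian motion. -/
noncomputable def covFun (H : ℝ) (q : unitInterval × unitInterval) : ℝ :=
  (|(q.1 : ℝ)| ^ (2 * H) + |(q.2 : ℝ)| ^ (2 * H) - |(q.1 : ℝ) - q.2| ^ (2 * H)) / 2

variable {H : ℝ}

theorem covDensity_nonneg (hH : 1 / 2 < H) (q : unitInterval × unitInterval) :
    0 ≤ covDensity H q :=
  mul_nonneg (mul_nonneg (by linarith) (by linarith)) (by positivity)

theorem covDensity_swap (q : unitInterval × unitInterval) :
    covDensity H q.swap = covDensity H q := by
  simp [covDensity, abs_sub_comm]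

theorem crossDensity_eq (q : unitInterval × unitInterval) :
    crossDensity H q = H * ((q.2 : ℝ) ^ (2 * H - 1) + signedRpow (2 * H - 1) ((q.1 : ℝ) - q.2)) :=
  rfl

theorem continuous_crossDensity (hH : 1 / 2 < H) : Continuous (crossDensity H) := by
  have hp : 0 < 2 * H - 1 := by linarith
  simp only [funext crossDensity_eq]
  exact continuous_const.mul (((continuous_subtype_val.comp continuous_snd).rpow_const
    fun _ => Or.inr hp.le).add ((continuous_signedRpow hp).comp (by fun_prop)))

/-- With `q = (t, u)`, the only negative contribution is the `p`-th power of the positive part of `u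
- t`, and `u - t ≤ u` because `t ≥ 0`. -/
theorem crossDensity_nonneg (hH : 1 / 2 < H) (q : unitInterval × unitInterval) :
    0 ≤ crossDensity H q := by
  have hp : 0 < 2 * H - 1 := by linarith
  rw [crossDensity_eq]
  refine mul_nonneg (by linarith) ?_
  rw [signedRpow_eq_max hp]
  have h1 : max (-((q.1 : ℝ) - q.2)) 0 ^ (2 * H - 1) ≤ (q.2 : ℝ) ^ (2 * H - 1) :=
    Real.rpow_le_rpow (le_max_right _ _) (max_le (by linarith [q.1.2.1]) q.2.2.1) hp.le
  have h2 : 0 ≤ max ((q.1 : ℝ) - q.2) 0 ^ (2 * H - 1) :=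
    Real.rpow_nonneg (le_max_right _ _) _
  linarith

theorem continuous_covFun (hH : 1 / 2 < H) : Continuous (covFun H) := by
  unfold covFun
  have h : ∀ f : unitInterval × unitInterval → ℝ, Continuous f →
      Continuous fun q => |f q| ^ (2 * H) := fun f hf =>
    hf.abs.rpow_const fun _ => Or.inr (by linarith)
  exact (((h _ (by fun_prop)).add (h _ (by fun_prop))).sub (h _ (by fun_prop))).div_const 2

/-- The distance of two points of `[0,1]` is at most the larger one. Nonnegativity is needed for
`secondMomentDensity` to define a positive measure. -/
theorem covFun_nonneg (hH : 1 / 2 < H) (q : unitInterval × unitInterval) : 0 ≤ covFun H q := by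
  unfold covFun
  rcases le_total (q.1 : ℝ) q.2 with h | h
  · have h1 : |(q.1 : ℝ) - q.2| ^ (2 * H) ≤ |(q.2 : ℝ)| ^ (2 * H) :=
      Real.rpow_le_rpow (abs_nonneg _) (by
        rw [abs_of_nonpos (by linarith), abs_of_nonneg q.2.2.1]; linarith [q.1.2.1]) (by linarith)
    have h2 : 0 ≤ |(q.1 : ℝ)| ^ (2 * H) := by positivity
    linarith
  · have h1 : |(q.1 : ℝ) - q.2| ^ (2 * H) ≤ |(q.1 : ℝ)| ^ (2 * H) :=
      Real.rpow_le_rpow (abs_nonneg _) (by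
        rw [abs_of_nonneg (by linarith), abs_of_nonneg q.1.2.1]; linarith [q.2.2.1]) (by linarith)
    have h2 : 0 ≤ |(q.2 : ℝ)| ^ (2 * H) := by positivity
    linarith

theorem integrable_covDensity_section (hH : 1 / 2 < H) (u : unitInterval) :
    Integrable fun v => covDensity H (u, v) := by
  have hp : 0 < 2 * H - 1 := by linarith
  have h := (intervalIntegrable_abs_rpow hp (0 - (u : ℝ)) (1 - u)).comp_sub_right (u : ℝ)
  simp only [sub_add_cancel] at h
  have h2 := (integrable_unitInterval h).const_mul (H * (2 * H - 1))
  refine h2.congr (Eventually.of_forall fun v => ?_)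
  simp only [covDensity, abs_sub_comm (u : ℝ) v]
  ring_nf

/-- First of the two integrations: the factor `2H - 1` cancels against the primitive, and the
boundary term at `v = 0` produces `u ^ (2H - 1)`. -/
theorem setIntegral_covDensity_section (hH : 1 / 2 < H) (u t : unitInterval) :
    ∫ v in Set.Icc 0 t, covDensity H (u, v) = crossDensity H (t, u) := by
  have hp : 0 < 2 * H - 1 := by linarith
  have h1 : ∀ v : unitInterval, covDensity H (u, v) =
      H * (2 * H - 1) * |(v : ℝ) - u| ^ (2 * H - 1 - 1) := fun v => by
    simp only [covDensity, abs_sub_comm (u : ℝ) v]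
    ring_nf
  simp only [h1]
  rw [setIntegral_Icc_unitInterval (fun v => H * (2 * H - 1) * |v - u| ^ (2 * H - 1 - 1)),
    intervalIntegral.integral_const_mul, integral_abs_rpow_sub hp, zero_sub, signedRpow_neg hp,
    signedRpow_of_nonneg hp u.2.1, crossDensity_eq]
  have hp0 := hp.ne'
  generalize 2 * H - 1 = p at hp0 ⊢
  field_simp
  ring

/-- The exact value is `H * (u ^ (2H - 1) + (1 - u) ^ (2H - 1))`. A bound uniform in `u` is what
Fubini integrability and the Schur test require. -/
theorem integral_covDensity_section_le (hH : 1 / 2 < H) (u : unitInterval) :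
    ∫ v, covDensity H (u, v) ≤ 2 * H := by
  have hp : 0 < 2 * H - 1 := by linarith
  have h := setIntegral_covDensity_section hH u 1
  have h1 : (Set.Icc 0 1 : Set unitInterval) = Set.univ := by
    ext x; simpa using unitInterval.le_one' (t := x)
  rw [h1, setIntegral_univ] at h
  rw [h, crossDensity_eq, signedRpow_of_nonneg hp (by simpa using u.2.2)]
  have h2 : (u : ℝ) ^ (2 * H - 1) ≤ 1 := Real.rpow_le_one u.2.1 u.2.2 hp.le
  have h3 : ((1 : unitInterval) - (u : ℝ)) ^ (2 * H - 1) ≤ 1 :=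
    Real.rpow_le_one (by simpa using u.2.2) (by simpa using u.2.1) hp.le
  nlinarith

theorem measurable_covDensity : Measurable (covDensity H) := by
  unfold covDensity
  have h : Measurable fun q : unitInterval × unitInterval => |(q.1 : ℝ) - q.2| := by fun_prop
  exact (h.pow_const _).const_mul _

theorem integrable_covDensity (hH : 1 / 2 < H) : Integrable (covDensity H) := by
  rw [Measure.volume_eq_prod, integrable_prod_iff measurable_covDensity.aestronglyMeasurable]
  refine ⟨Eventually.of_forall fun u => integrable_covDensity_section hH u, ?_⟩
  simp only [Real.norm_of_nonneg (covDensity_nonneg hH _)]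
  refine Integrable.of_bound (C := 2 * H)
    (measurable_covDensity.stronglyMeasurable.integral_prod_right').aestronglyMeasurable
    (Eventually.of_forall fun u => ?_)
  rw [Real.norm_of_nonneg (integral_nonneg fun v => covDensity_nonneg hH _)]
  exact integral_covDensity_section_le hH u

/-- Second integration: the two signed powers integrate to `s ^ (2H)` and `|s - t| ^ (2H)`, and the
boundary term at `0` supplies `t ^ (2H)`. -/
theorem setIntegral_crossDensity (hH : 1 / 2 < H) (s t : unitInterval) :
    ∫ u in Set.Icc 0 s, crossDensity H (t, u) = covFun H (t, s) := by
  have hp : 0 < 2 * H - 1 := by linarith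
  have h1 : ∀ u : unitInterval, crossDensity H (t, u) =
      H * (signedRpow (2 * H - 1) ((u : ℝ) - 0) - signedRpow (2 * H - 1) ((u : ℝ) - t)) :=
    fun u => by
      rw [crossDensity_eq, sub_zero, signedRpow_of_nonneg hp u.2.1, ← neg_sub (u : ℝ) t,
        signedRpow_neg hp]
      ring
  simp only [h1]
  have hc : ∀ c : ℝ, Continuous fun u => signedRpow (2 * H - 1) (u - c) := fun c =>
    (continuous_signedRpow hp).comp (by fun_prop)
  rw [setIntegral_Icc_unitInterval
    (fun u => H * (signedRpow (2 * H - 1) (u - 0) - signedRpow (2 * H - 1) (u - t))),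
    intervalIntegral.integral_const_mul, intervalIntegral.integral_sub
      ((hc _).intervalIntegrable _ _) ((hc _).intervalIntegrable _ _),
    integral_signedRpow_sub hp, integral_signedRpow_sub hp, covFun, abs_sub_comm (t : ℝ) s]
  have hz : (0 : ℝ) ^ (2 * H) = 0 := Real.zero_rpow (by linarith)
  have hHpos : H ≠ 0 := by linarith
  simp only [sub_zero, zero_sub, abs_neg, abs_zero, sub_add_cancel, hz]
  field_simp
  ring

theorem integral_crossDensity_diag (hH : 1 / 2 < H) :
    ∫ u, crossDensity H (u, u) = 1 / 2 := by
  have h1 : ∀ u : unitInterval, crossDensity H (u, u) = H * (u : ℝ) ^ (2 * H - 1) := fun u => by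
    simp [crossDensity]
  simp only [h1]
  rw [integral_unitInterval (fun u => H * u ^ (2 * H - 1)), intervalIntegral.integral_const_mul,
    integral_rpow (Or.inl (by linarith)), sub_add_cancel, Real.one_rpow,
    Real.zero_rpow (by linarith)]
  field_simp
  ring

end CovarianceKernel

end

/-! ### Explicit value of the quasi-self-integral -/

section

theorem beta_eq_intervalIntegral {α β : ℝ} (hα : 0 < α) (hβ : 0 < β) :
    ProbabilityTheory.beta α β = ∫ x in (0 : ℝ)..1, x ^ (α - 1) * (1 - x) ^ (β - 1) := by
  rw [beta_eq_betaIntegralReal α β hα hβ, Complex.betaIntegral]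
  have h : ∫ x in (0 : ℝ)..1, (x : ℂ) ^ ((α : ℂ) - 1) * (1 - (x : ℂ)) ^ ((β : ℂ) - 1) =
      ∫ x in (0 : ℝ)..1, ((x ^ (α - 1) * (1 - x) ^ (β - 1) : ℝ) : ℂ) := by
    refine intervalIntegral.integral_congr fun x hx => ?_
    rw [Set.uIcc_of_le zero_le_one] at hx
    rw [Complex.ofReal_mul, Complex.ofReal_cpow hx.1, Complex.ofReal_cpow (sub_nonneg.2 hx.2)]
    push_cast
    rfl
  rw [h, intervalIntegral.integral_ofReal, Complex.ofReal_re]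

theorem integrable_of_continuous_of_compactSpace {Y : Type*} [TopologicalSpace Y] [CompactSpace Y]
    [MeasurableSpace Y] [OpensMeasurableSpace Y] [SecondCountableTopology Y]
    (ρ : Measure Y) [IsFiniteMeasure ρ] {f : Y → ℝ}
    (hf : Continuous f) : Integrable f ρ :=
  hf.integrable_of_hasCompactSupport (HasCompactSupport.of_compactSpace f)

section QuasiSelfIntegral

variable {H : ℝ}

/-- Source of the beta function: integrating out the second variable leaves `u ^ p * ((1 - u) ^ (p +
1) - u ^ (p + 1)) / (p + 1)`. -/
theorem integral_rpow_mul_signedRpow {p : ℝ} (hp : 0 < p) :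
    ∫ q : unitInterval × unitInterval, (q.1 : ℝ) ^ p * signedRpow p ((q.2 : ℝ) - q.1) =
      (ProbabilityTheory.beta (p + 1) (p + 2) - 1 / (2 * p + 2)) / (p + 1) := by
  have hc : Continuous fun q : unitInterval × unitInterval =>
      (q.1 : ℝ) ^ p * signedRpow p ((q.2 : ℝ) - q.1) :=
    ((continuous_subtype_val.comp continuous_fst).rpow_const fun _ => Or.inr hp.le).mul
      ((continuous_signedRpow hp).comp (by fun_prop))
  rw [Measure.volume_eq_prod, integral_prod _ (integrable_of_continuous_of_compactSpace _ hc)]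
  have h1 : ∀ u : unitInterval, ∫ v : unitInterval, (u : ℝ) ^ p * signedRpow p ((v : ℝ) - u) =
      ((u : ℝ) ^ (p + 1 - 1) * (1 - (u : ℝ)) ^ (p + 2 - 1) - (u : ℝ) ^ (2 * p + 1)) / (p + 1) := by
    intro u
    have he : (u : ℝ) ^ (2 * p + 1) = (u : ℝ) ^ p * (u : ℝ) ^ (p + 1) := by
      rw [← Real.rpow_add_of_nonneg u.2.1 hp.le (by linarith)]
      ring_nf
    rw [integral_unitInterval (fun v => (u : ℝ) ^ p * signedRpow p (v - u)),
      intervalIntegral.integral_const_mul, integral_signedRpow_sub hp,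
      abs_of_nonneg (sub_nonneg.2 u.2.2), zero_sub, abs_neg, abs_of_nonneg u.2.1,
      he, show p + 1 - 1 = p by ring, show p + 2 - 1 = p + 1 by ring]
    ring
  simp only [h1]
  have hi1 : Continuous fun u : ℝ => u ^ (p + 1 - 1) * (1 - u) ^ (p + 2 - 1) :=
    (continuous_id.rpow_const fun _ => Or.inr (by linarith)).mul
      ((continuous_const.sub continuous_id).rpow_const fun _ => Or.inr (by linarith))
  have hi2 : Continuous fun u : ℝ => u ^ (2 * p + 1) :=
    continuous_id.rpow_const fun _ => Or.inr (by linarith)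
  rw [integral_unitInterval
    (fun u => (u ^ (p + 1 - 1) * (1 - u) ^ (p + 2 - 1) - u ^ (2 * p + 1)) / (p + 1)),
    intervalIntegral.integral_div, intervalIntegral.integral_sub (hi1.intervalIntegrable _ _)
    (hi2.intervalIntegrable _ _), ← beta_eq_intervalIntegral (by linarith) (by linarith),
    integral_rpow (Or.inl (by linarith)), Real.one_rpow, Real.zero_rpow (by linarith)]
  ring_nf

theorem integral_abs_rpow_prod {p : ℝ} (hp : 0 < p) :
    ∫ q : unitInterval × unitInterval, |(q.2 : ℝ) - q.1| ^ p = 2 / ((p + 1) * (p + 2)) := by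
  have hc : Continuous fun q : unitInterval × unitInterval => |(q.2 : ℝ) - q.1| ^ p :=
    Continuous.rpow_const (f := fun q : unitInterval × unitInterval => |(q.2 : ℝ) - q.1|)
      (by fun_prop) fun _ => Or.inr hp.le
  rw [Measure.volume_eq_prod, integral_prod _ (integrable_of_continuous_of_compactSpace _ hc)]
  have hp1 : 0 < p + 1 := by linarith
  have h1 : ∀ u : unitInterval, ∫ v : unitInterval, |(v : ℝ) - u| ^ p =
      ((1 - (u : ℝ)) ^ (p + 1) + (u : ℝ) ^ (p + 1)) / (p + 1) := by
    intro u
    have := integral_abs_rpow_sub hp1 u 0 1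
    rw [add_sub_cancel_right] at this
    rw [integral_unitInterval (fun v => |v - u| ^ p), this, zero_sub, signedRpow_neg hp1,
      signedRpow_of_nonneg hp1 u.2.1, signedRpow_of_nonneg hp1 (sub_nonneg.2 u.2.2), sub_neg_eq_add]
  simp only [h1]
  have hi2 : Continuous fun u : ℝ => u ^ (p + 1) :=
    continuous_id.rpow_const fun _ => Or.inr (by linarith)
  have hi1 : Continuous fun u : ℝ => (1 - u) ^ (p + 1) := hi2.comp (by fun_prop)
  rw [integral_unitInterval (fun u => ((1 - u) ^ (p + 1) + u ^ (p + 1)) / (p + 1)),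
    intervalIntegral.integral_div, intervalIntegral.integral_add (hi1.intervalIntegrable _ _)
    (hi2.intervalIntegrable _ _),
    intervalIntegral.integral_comp_sub_left (fun u : ℝ => u ^ (p + 1)) 1, sub_zero, sub_self,
    integral_rpow (Or.inl (by linarith)), Real.one_rpow, Real.zero_rpow (by linarith)]
  field_simp
  ring

theorem integral_rpow_mul_rpow {p : ℝ} (hp : 0 < p) :
    ∫ q : unitInterval × unitInterval, (q.1 : ℝ) ^ p * (q.2 : ℝ) ^ p = (1 / (p + 1)) ^ 2 := by
  rw [Measure.volume_eq_prod, integral_prod_mul (fun u : unitInterval => (u : ℝ) ^ p)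
    (fun u : unitInterval => (u : ℝ) ^ p), integral_unitInterval (fun u => u ^ p),
    integral_rpow (Or.inl (by linarith)), Real.one_rpow, Real.zero_rpow (by linarith)]
  ring

/-- With `w` the signed power of `v - u`, the integrand is `H² (u^p + w)(v^p - w)`. The two mixed
terms have equal integrals by symmetry, and `w² = |v - u| ^ (2p)`. -/
theorem integral_crossDensity_mul_swap (hH : 1 / 2 < H) :
    ∫ q : unitInterval × unitInterval, crossDensity H q.swap * crossDensity H q =
      1 / 2 - H * ProbabilityTheory.beta (2 * H) (2 * H + 1) - H / (2 * (4 * H - 1)) := by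
  have hp : 0 < 2 * H - 1 := by linarith
  set p := 2 * H - 1 with hpdef
  have hcp : Continuous fun u : unitInterval => (u : ℝ) ^ p :=
    continuous_subtype_val.rpow_const fun _ => Or.inr hp.le
  let f₁ : unitInterval × unitInterval → ℝ := fun q => (q.1 : ℝ) ^ p * (q.2 : ℝ) ^ p
  let f₂ : unitInterval × unitInterval → ℝ := fun q =>
    (q.1 : ℝ) ^ p * signedRpow p ((q.2 : ℝ) - q.1)
  let f₃ : unitInterval × unitInterval → ℝ := fun q => |(q.2 : ℝ) - q.1| ^ (2 * p)
  have hc1 : Continuous f₁ := (hcp.comp continuous_fst).mul (hcp.comp continuous_snd)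
  have hc2 : Continuous f₂ := (hcp.comp continuous_fst).mul
    ((continuous_signedRpow hp).comp (by fun_prop))
  have hc3 : Continuous f₃ := Continuous.rpow_const
    (f := fun q : unitInterval × unitInterval => |(q.2 : ℝ) - q.1|)
    (by fun_prop) fun _ => Or.inr (by linarith)
  have hi : ∀ f : unitInterval × unitInterval → ℝ, Continuous f → Integrable f := fun f hf =>
    integrable_of_continuous_of_compactSpace _ hf
  have hsq : ∀ x : ℝ, signedRpow p x * signedRpow p x = |x| ^ (2 * p) := by
    intro x
    have h2 : |x| ^ (2 * p) = |x| ^ p * |x| ^ p := by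
      rw [two_mul, Real.rpow_add_of_nonneg (abs_nonneg x) hp.le hp.le]
    rcases lt_trichotomy x 0 with h | h | h
    · rw [h2, signedRpow, Real.sign_of_neg h]; ring
    · subst h
      simp [signedRpow, Real.zero_rpow (show 2 * p ≠ 0 by positivity)]
    · rw [h2, signedRpow, Real.sign_of_pos h]; ring
  have hE : ∀ q : unitInterval × unitInterval, crossDensity H q.swap * crossDensity H q =
      H ^ 2 * (f₁ q - f₂ q.swap - f₂ q - f₃ q) := by
    intro q
    have h1 : signedRpow p ((q.1 : ℝ) - q.2) = -signedRpow p ((q.2 : ℝ) - q.1) := by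
      rw [← signedRpow_neg hp, neg_sub]
    rw [crossDensity_eq, crossDensity_eq, ← hpdef]
    simp only [Prod.fst_swap, Prod.snd_swap, f₁, f₂, f₃, ← hsq, h1]
    ring
  have hsw : ∫ q : unitInterval × unitInterval, f₂ q.swap = ∫ q, f₂ q :=
    integral_prod_swap (μ := (volume : Measure unitInterval)) (ν := volume) f₂
  have hi2s : Integrable fun q : unitInterval × unitInterval => f₂ q.swap :=
    hi _ (hc2.comp continuous_swap)
  have hi12 : Integrable fun q => f₁ q - f₂ q.swap := (hi _ hc1).sub hi2s
  have hi122 : Integrable fun q => f₁ q - f₂ q.swap - f₂ q := hi12.sub (hi _ hc2)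
  simp only [hE]
  rw [integral_const_mul, integral_sub hi122 (hi _ hc3), integral_sub hi12 (hi _ hc2),
    integral_sub (hi _ hc1) hi2s, hsw]
  simp only [f₁, f₂, f₃]
  rw [integral_rpow_mul_rpow hp, integral_rpow_mul_signedRpow hp,
    integral_abs_rpow_prod (p := 2 * p) (by linarith)]
  rw [show p + 1 = 2 * H by ring, show p + 2 = 2 * H + 1 by ring,
    show 2 * p + 1 = 4 * H - 1 by ring, show 2 * p + 2 = 4 * H by ring]
  have h1 : 4 * H - 1 ≠ 0 := by linarith
  have h2 : H ≠ 0 := by linarith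
  field_simp
  ring

end QuasiSelfIntegral

end

/-! ### Gaussian subspaces of `L²(P)` and Isserlis' formula -/

section

theorem holderTriple_four_four_two : ENNReal.HolderTriple 4 4 2 := ⟨by
  rw [show (4 : ℝ≥0∞) = 2 * 2 by norm_num,
    ENNReal.mul_inv (by simp) (by simp), ← mul_add, ENNReal.inv_two_add_inv_two, mul_one]⟩

theorem integral_pow_four_gaussianReal (v : NNReal) :
    ∫ x, x ^ 4 ∂(gaussianReal 0 v) = 3 * (v : ℝ) ^ 2 := by
  have h : ∫ x, x ^ 4 ∂(gaussianReal 0 v) =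
      iteratedDeriv 4 (mgf (fun x => x) (gaussianReal 0 v)) 0 := by
    rw [iteratedDeriv_mgf_zero] <;> simp
  rw [h, mgf_fun_id_gaussianReal]
  simp only [zero_mul, zero_add]
  -- Differentiating `a * exp (v t² / 2)` replaces the polynomial `a` by `a' + v t a`. Starting from
  -- `1`, four such steps give a polynomial with value `3 v²` at `0`.
  have key : ∀ (a b : ℝ → ℝ), (∀ t, HasDerivAt a (b t) t) →
      deriv (fun t => a t * Real.exp (v * t ^ 2 / 2)) =
        fun t => (b t + a t * (v * t)) * Real.exp (v * t ^ 2 / 2) := by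
    intro a b hab
    ext t
    have h1 : HasDerivAt (fun t : ℝ => Real.exp (v * t ^ 2 / 2))
        (Real.exp (v * t ^ 2 / 2) * (v * t)) t := by
      have := ((((hasDerivAt_id t).pow 2).const_mul (v : ℝ)).div_const 2).exp
      refine this.congr_deriv ?_
      simp
      ring
    refine (((hab t).mul h1).congr_deriv ?_).deriv
    ring
  have e0 : (fun t : ℝ => Real.exp (v * t ^ 2 / 2)) =
      fun t : ℝ => (fun _ => (1 : ℝ)) t * Real.exp (v * t ^ 2 / 2) := by
    simp
  have e1 : ∀ t : ℝ, HasDerivAt (fun t : ℝ => (v : ℝ) * t) v t := fun t => by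
    simpa using (hasDerivAt_id t).const_mul (v : ℝ)
  have e2 : ∀ t : ℝ, HasDerivAt (fun t : ℝ => (v : ℝ) + (v : ℝ) ^ 2 * t ^ 2)
      (2 * (v : ℝ) ^ 2 * t) t := fun t => by
    refine ((((hasDerivAt_id t).pow 2).const_mul ((v : ℝ) ^ 2)).const_add (v : ℝ)).congr_deriv ?_
    simp
    ring
  have e3 : ∀ t : ℝ, HasDerivAt (fun t : ℝ => 3 * (v : ℝ) ^ 2 * t + (v : ℝ) ^ 3 * t ^ 3)
      (3 * (v : ℝ) ^ 2 + 3 * (v : ℝ) ^ 3 * t ^ 2) t := fun t => by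
    refine (((hasDerivAt_id t).const_mul (3 * (v : ℝ) ^ 2)).add
      (((hasDerivAt_id t).pow 3).const_mul ((v : ℝ) ^ 3))).congr_deriv ?_
    simp
    ring
  rw [iteratedDeriv_succ, iteratedDeriv_succ, iteratedDeriv_succ, iteratedDeriv_one, e0,
    key _ (fun _ => 0) fun t => hasDerivAt_const t 1]
  have e0' : (fun t : ℝ => (0 + 1 * ((v : ℝ) * t)) * Real.exp (v * t ^ 2 / 2)) =
      fun t => (v * t) * Real.exp (v * t ^ 2 / 2) := by
    ext t; ring
  rw [e0', key _ _ e1]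
  have e1' : (fun t : ℝ => ((v : ℝ) + v * t * (v * t)) * Real.exp (v * t ^ 2 / 2)) =
      fun t => (v + (v : ℝ) ^ 2 * t ^ 2) * Real.exp (v * t ^ 2 / 2) := by
    ext t; ring
  rw [e1', key _ _ e2]
  have e2' : (fun t : ℝ => (2 * (v : ℝ) ^ 2 * t + (v + (v : ℝ) ^ 2 * t ^ 2) * (v * t)) *
      Real.exp (v * t ^ 2 / 2)) =
      fun t => (3 * (v : ℝ) ^ 2 * t + (v : ℝ) ^ 3 * t ^ 3) * Real.exp (v * t ^ 2 / 2) := by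
    ext t; ring
  rw [e2', key _ _ e3]
  simp

variable {Ω : Type*} [MeasurableSpace Ω] {P : Measure Ω}

/-- An element of `L²(P)` is a centred Gaussian random variable. -/
def IsCentredGaussian (P : Measure Ω) (w : Lp ℝ 2 P) : Prop :=
  P.map w = gaussianReal 0 (‖w‖₊ ^ 2)

theorem integral_sq_eq_norm_sq (w : Lp ℝ 2 P) : ∫ ω, w ω ^ 2 ∂P = ‖w‖ ^ 2 := by
  rw [← real_inner_self_eq_norm_sq, L2.inner_def]
  simp [sq]

theorem isCentredGaussian_of_hasGaussianLaw {w : Lp ℝ 2 P} (h : HasGaussianLaw w P)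
    (h0 : ∫ ω, w ω ∂P = 0) : IsCentredGaussian P w := by
  rw [IsCentredGaussian, h.map_eq_gaussianReal, h0]
  congr 1
  rw [variance_of_integral_eq_zero h.aemeasurable h0, integral_sq_eq_norm_sq]
  ext
  rw [Real.coe_toNNReal _ (by positivity)]
  simp

theorem aemeasurable_Lp (w : Lp ℝ 2 P) : AEMeasurable w P :=
  (Lp.aestronglyMeasurable w).aemeasurable

theorem IsCentredGaussian.memLp_four {w : Lp ℝ 2 P} (h : IsCentredGaussian P w) :
    MemLp w 4 P := by
  have h1 := memLp_id_gaussianReal' (μ := 0) (v := ‖w‖₊ ^ 2) 4 (by simp)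
  rw [← h] at h1
  exact (memLp_map_measure_iff aestronglyMeasurable_id (aemeasurable_Lp w)).1 h1

theorem IsCentredGaussian.integral_pow_four {w : Lp ℝ 2 P} (h : IsCentredGaussian P w) :
    ∫ ω, w ω ^ 4 ∂P = 3 * (‖w‖ ^ 2) ^ 2 := by
  have h1 := integral_pow_four_gaussianReal (‖w‖₊ ^ 2)
  rw [← h, integral_map (aemeasurable_Lp w) (by fun_prop)] at h1
  simpa using h1

theorem IsCentredGaussian.integral_eq_zero {w : Lp ℝ 2 P} (h : IsCentredGaussian P w) :
    ∫ ω, w ω ∂P = 0 := by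
  have h1 := integral_id_gaussianReal (μ := 0) (v := ‖w‖₊ ^ 2)
  rw [← h, integral_map (aemeasurable_Lp w) (by fun_prop)] at h1
  exact h1

/-- Limits in `L²(P)` of centred Gaussian variables are centred Gaussian. -/
theorem isClosed_isCentredGaussian [IsProbabilityMeasure P] : IsClosed {w : Lp ℝ 2 P | IsCentredGaussian P w} := by
  refine IsSeqClosed.isClosed fun f w hf hw => ?_
  have : IsProbabilityMeasure (P.map w) :=
    Measure.isProbabilityMeasure_map (aemeasurable_Lp w)
  refine Measure.ext_of_charFun (funext fun t => ?_)
  -- Along an a.e. convergent subsequence the characteristic functions converge by domination. The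
  -- Gaussian ones depend continuously on the norm, so the limit is again Gaussian.
  obtain ⟨ns, hns, hae⟩ := (tendstoInMeasure_of_tendsto_Lp hw).exists_seq_tendsto_ae
  have hchar : ∀ v : Lp ℝ 2 P, charFun (P.map v) t =
      ∫ ω, Complex.exp (t * (v ω : ℝ) * Complex.I) ∂P := fun v => by
    rw [charFun_apply_real, integral_map (aemeasurable_Lp v)
      (Continuous.aestronglyMeasurable (by fun_prop))]
  have h1 : Tendsto (fun k => charFun (P.map (f (ns k))) t) atTop (𝓝 (charFun (P.map w) t)) := by
    simp only [hchar]
    refine tendsto_integral_of_dominated_convergence (fun _ => (1 : ℝ)) (fun k => ?_)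
      (integrable_const _) (fun k => Eventually.of_forall fun ω => ?_) ?_
    · have hc : Continuous fun x : ℝ => Complex.exp (t * x * Complex.I) := by fun_prop
      exact hc.comp_aestronglyMeasurable (Lp.aestronglyMeasurable _)
    · rw [← Complex.ofReal_mul, Complex.norm_exp_ofReal_mul_I]
    · filter_upwards [hae] with ω hω
      have hc : Continuous fun x : ℝ => Complex.exp (t * x * Complex.I) := by fun_prop
      exact (hc.tendsto _).comp hω
  have h2 : Tendsto (fun k => charFun (P.map (f (ns k))) t) atTop
      (𝓝 (charFun (gaussianReal 0 (‖w‖₊ ^ 2)) t)) := by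
    have h3 : ∀ k, P.map (f (ns k)) = gaussianReal 0 (‖f (ns k)‖₊ ^ 2) := fun k => hf (ns k)
    simp only [h3, charFun_gaussianReal]
    have hc : Continuous fun v : Lp ℝ 2 P => Complex.exp ((t : ℂ) * ((0 : ℝ) : ℂ) * Complex.I -
        (((‖v‖₊ ^ 2 : NNReal) : ℝ) : ℂ) * (t : ℂ) ^ 2 / 2) := by
      fun_prop
    exact (hc.tendsto w).comp (hw.comp hns.tendsto_atTop)
  exact tendsto_nhds_unique h1 h2

/-- The closed linear span of a process in `L²(P)`. -/
noncomputable def closedSpan {T : Type*} {Z : T → Ω → ℝ} (hZ : ∀ t, MemLp (Z t) 2 P) :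
    Submodule ℝ (Lp ℝ 2 P) :=
  (Submodule.span ℝ (Set.range fun t => (hZ t).toLp (Z t))).topologicalClosure

theorem toLp_mem_closedSpan {T : Type*} {Z : T → Ω → ℝ} (hZ : ∀ t, MemLp (Z t) 2 P) (t : T) :
    (hZ t).toLp (Z t) ∈ closedSpan hZ :=
  Submodule.le_topologicalClosure _ (Submodule.subset_span ⟨t, rfl⟩)

/-- Finite linear combinations of a centred Gaussian process are centred Gaussian, and this property
is closed in `L²(P)`. -/
theorem isCentredGaussian_of_mem_closedSpan [IsProbabilityMeasure P] {T : Type*} {Z : T → Ω → ℝ}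
    (hZ : ∀ t, MemLp (Z t) 2 P) (hG : IsGaussianProcess Z P) (h0 : ∀ t, ∫ ω, Z t ω ∂P = 0)
    {w : Lp ℝ 2 P} (hw : w ∈ closedSpan hZ) : IsCentredGaussian P w := by
  refine closure_minimal (fun v hv => ?_) isClosed_isCentredGaussian hw
  obtain ⟨c, rfl⟩ := Finsupp.mem_span_range_iff_exists_finsupp.1 hv
  have hae : ((c.sum fun t a => a • (hZ t).toLp (Z t) : Lp ℝ 2 P) : Ω → ℝ) =ᵐ[P]
      fun ω => ∑ t ∈ c.support, (c t • Z t ω) := by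
    have h1 : ∀ t ∈ c.support, ((c t • (hZ t).toLp (Z t) : Lp ℝ 2 P) : Ω → ℝ) =ᵐ[P]
        fun ω => c t • Z t ω := fun t _ => by
      filter_upwards [Lp.coeFn_smul (c t) ((hZ t).toLp (Z t)), (hZ t).coeFn_toLp] with ω h h'
      rw [h, Pi.smul_apply, h']
    filter_upwards [Lp.coeFn_finsetSum c.support fun t => c t • (hZ t).toLp (Z t),
      (Finset.eventually_all _).2 h1] with ω h h'
    rw [Finsupp.sum, h, Finset.sum_apply]
    exact Finset.sum_congr rfl h'
  refine isCentredGaussian_of_hasGaussianLaw ?_ ?_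
  · exact HasGaussianLaw.congr ((hG.smul c).hasGaussianLaw_fun_sum) hae.symm
  · rw [integral_congr_ae hae, integral_finsetSum (f := fun t ω => c t • Z t ω) _ fun t _ =>
      ((hZ t).integrable (by norm_num)).smul (c t)]
    simp [integral_const_mul, h0]

theorem integrable_mul_mul_mul {a b c d : Ω → ℝ} (ha : MemLp a 4 P) (hb : MemLp b 4 P)
    (hc : MemLp c 4 P) (hd : MemLp d 4 P) :
    Integrable (fun ω => a ω * b ω * (c ω * d ω)) P := by
  have := holderTriple_four_four_two
  exact (hb.mul ha (r := 2)).integrable_mul (hd.mul hc (r := 2))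

/-- Isserlis' formula for four elements of a Gaussian subspace of `L²(P)`. -/
theorem integral_mul_mul_mul_of_gaussian {V : Submodule ℝ (Lp ℝ 2 P)}
    (hV : ∀ w ∈ V, IsCentredGaussian P w) {a b c d : Lp ℝ 2 P}
    (ha : a ∈ V) (hb : b ∈ V) (hc : c ∈ V) (hd : d ∈ V) :
    ∫ ω, a ω * b ω * (c ω * d ω) ∂P =
      inner ℝ a b * inner ℝ c d + inner ℝ a c * inner ℝ b d + inner ℝ a d * inner ℝ b c := by
  -- Polarization: `abcd` is the signed sum of `(a ± b ± c ± d)⁴` over eight sign choices, divided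
  -- by `192 = 8 * 4!`. Thus only the fourth moment of a single Gaussian variable is needed.
  let w : ℝ → ℝ → ℝ → Lp ℝ 2 P := fun x y z => a + x • b + y • c + z • d
  have hw : ∀ x y z, w x y z ∈ V := fun x y z =>
    V.add_mem (V.add_mem (V.add_mem ha (V.smul_mem x hb)) (V.smul_mem y hc)) (V.smul_mem z hd)
  have hint : ∀ x y z, Integrable (fun ω => w x y z ω ^ 4) P := fun x y z => by
    have h4 := (hV _ (hw x y z)).memLp_four
    refine (integrable_mul_mul_mul h4 h4 h4 h4).congr (Eventually.of_forall fun ω => ?_)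
    ring
  have hcoe : ∀ x y z, w x y z =ᵐ[P] fun ω => a ω + x * b ω + y * c ω + z * d ω := fun x y z => by
    filter_upwards [Lp.coeFn_add (a + x • b + y • c) (z • d), Lp.coeFn_add (a + x • b) (y • c),
      Lp.coeFn_add a (x • b), Lp.coeFn_smul x b, Lp.coeFn_smul y c, Lp.coeFn_smul z d]
      with ω h1 h2 h3 h4 h5 h6
    simp only [w]
    rw [h1, Pi.add_apply, h2, Pi.add_apply, h3, Pi.add_apply, h4, h5, h6]
    simp
  have hid : (fun ω => a ω * b ω * (c ω * d ω)) =ᵐ[P] fun ω => (1 / 192) *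
      ((w 1 1 1 ω ^ 4 - w 1 1 (-1) ω ^ 4 - w 1 (-1) 1 ω ^ 4 + w 1 (-1) (-1) ω ^ 4) -
      (w (-1) 1 1 ω ^ 4 - w (-1) 1 (-1) ω ^ 4 - w (-1) (-1) 1 ω ^ 4 +
        w (-1) (-1) (-1) ω ^ 4)) := by
    filter_upwards [hcoe 1 1 1, hcoe 1 1 (-1), hcoe 1 (-1) 1, hcoe 1 (-1) (-1), hcoe (-1) 1 1,
      hcoe (-1) 1 (-1), hcoe (-1) (-1) 1, hcoe (-1) (-1) (-1)] with ω h1 h2 h3 h4 h5 h6 h7 h8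
    rw [h1, h2, h3, h4, h5, h6, h7, h8]
    ring
  have hA : ∀ x, Integrable (fun ω => w x 1 1 ω ^ 4 - w x 1 (-1) ω ^ 4) P := fun x =>
    (hint _ _ _).sub (hint _ _ _)
  have hB : ∀ x, Integrable (fun ω => w x 1 1 ω ^ 4 - w x 1 (-1) ω ^ 4 - w x (-1) 1 ω ^ 4) P :=
    fun x => (hA x).sub (hint _ _ _)
  have hC : ∀ x, Integrable (fun ω => w x 1 1 ω ^ 4 - w x 1 (-1) ω ^ 4 - w x (-1) 1 ω ^ 4 +
      w x (-1) (-1) ω ^ 4) P := fun x => (hB x).add (hint _ _ _)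
  have hnorm : ∀ x y z, ∫ ω, w x y z ω ^ 4 ∂P = 3 * (inner ℝ a a + x ^ 2 * inner ℝ b b +
      y ^ 2 * inner ℝ c c + z ^ 2 * inner ℝ d d + 2 * (x * inner ℝ a b + y * inner ℝ a c +
      z * inner ℝ a d + x * y * inner ℝ b c + x * z * inner ℝ b d +
      y * z * inner ℝ c d)) ^ 2 := fun x y z => by
    rw [(hV _ (hw x y z)).integral_pow_four, ← real_inner_self_eq_norm_sq]
    simp only [w, inner_add_left, inner_add_right, inner_smul_left, inner_smul_right,
      real_inner_comm a b, real_inner_comm a c, real_inner_comm a d, real_inner_comm b c,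
      real_inner_comm b d, real_inner_comm c d, conj_trivial]
    ring
  rw [integral_congr_ae hid, integral_const_mul, integral_sub (hC 1) (hC (-1)),
    integral_add (hB 1) (hint _ _ _), integral_sub (hA 1) (hint _ _ _),
    integral_sub (hint _ _ _) (hint _ _ _), integral_add (hB (-1)) (hint _ _ _),
    integral_sub (hA (-1)) (hint _ _ _), integral_sub (hint _ _ _) (hint _ _ _)]
  simp only [hnorm]
  ring

end

/-! ### Consequences of the primitive `B`: covariances and kernels -/

section

variable {Ω : Type*} [MeasurableSpace Ω] {P : Measure Ω}

theorem continuous_setIntegral_of_continuous {X Y : Type*} [TopologicalSpace X] [CompactSpace X]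
    [FirstCountableTopology X] [TopologicalSpace Y] [CompactSpace Y] [SecondCountableTopology Y]
    [MeasurableSpace Y] [OpensMeasurableSpace Y] (ρ : Measure Y) [IsFiniteMeasure ρ]
    {G : X × Y → ℝ} (hG : Continuous G) (A : Set Y) :
    Continuous fun x => ∫ y in A, G (x, y) ∂ρ := by
  obtain ⟨C, hC⟩ := isCompact_univ.exists_bound_of_continuousOn hG.continuousOn
  refine continuous_of_dominated (bound := fun _ => C) (fun x => ?_)
    (fun x => Eventually.of_forall fun y => hC _ (Set.mem_univ _)) (integrable_const C)
    (Eventually.of_forall fun y => hG.comp (by fun_prop))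
  exact (hG.comp (by fun_prop : Continuous fun y => (x, y))).aestronglyMeasurable

/-- Testing an `L²(P)`-valued measure against an element of `L²(P)`. -/
noncomputable def testMeasure {X : Type*} [MeasurableSpace X] (M : VectorMeasure X (Lp ℝ 2 P))
    (y : Lp ℝ 2 P) : SignedMeasure X :=
  M.mapRange (innerSL ℝ y : Lp ℝ 2 P →L[ℝ] ℝ).toLinearMap.toAddMonoidHom
    (innerSL ℝ y : Lp ℝ 2 P →L[ℝ] ℝ).continuous

theorem testMeasure_apply {X : Type*} [MeasurableSpace X] (M : VectorMeasure X (Lp ℝ 2 P))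
    (y : Lp ℝ 2 P) (A : Set X) : testMeasure M y A = inner ℝ y (M A) := rfl

section Primitive

variable {Z : unitInterval → Ω → ℝ} {hZ : ∀ t, MemLp (Z t) 2 P}
  {M : VectorMeasure unitInterval (Lp ℝ 2 P)}

/-- The scalar measure `⟪y, M ·⟫` is determined by its distribution function, so inner products with
`M` can be read off from those with the process. -/
theorem inner_apply_eq_of_primitive (hM : ∀ t, M (Set.Icc 0 t) = (hZ t).toLp (Z t))
    {y : Lp ℝ 2 P} {μ : SignedMeasure unitInterval}
    (h : ∀ t, inner ℝ y ((hZ t).toLp (Z t)) = μ (Set.Icc 0 t)) (A : Set unitInterval) :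
    inner ℝ y (M A) = μ A := by
  rw [← testMeasure_apply]
  congr 1
  refine vectorMeasure_ext_Icc fun t => ?_
  rw [testMeasure_apply, hM, h]

/-- If `y` is orthogonal to every `Z t`, then `⟪y, M ·⟫` has zero distribution function and
vanishes; a closed subspace is its double orthogonal complement. For Gaussian `Z` this makes `M A`
Gaussian. -/
theorem apply_mem_closedSpan_of_primitive (hM : ∀ t, M (Set.Icc 0 t) = (hZ t).toLp (Z t))
    (A : Set unitInterval) : M A ∈ closedSpan hZ := by
  have hcl : IsClosed (closedSpan hZ : Set (Lp ℝ 2 P)) := Submodule.isClosed_topologicalClosure _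
  have : CompleteSpace (closedSpan hZ) := hcl.completeSpace_coe
  rw [← Submodule.orthogonal_orthogonal (closedSpan hZ), Submodule.mem_orthogonal]
  intro y hy
  refine inner_apply_eq_of_primitive hM (μ := 0) (fun t => ?_) A
  rw [real_inner_comm]
  exact (Submodule.mem_orthogonal _ _).1 hy _ (toLp_mem_closedSpan hZ t)

end Primitive

section FractionalBrownianMotion

variable [IsProbabilityMeasure P] {H : ℝ} {B : unitInterval → Ω → ℝ}

theorem IsFractionalBrownianMotion.inner_toLp (hB : IsFractionalBrownianMotion H B P)
    (s t : unitInterval) :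
    inner ℝ ((hB.memLp s).toLp (B s)) ((hB.memLp t).toLp (B t)) = covFun H (s, t) := by
  have h := hB.cov_eq s t
  rw [covariance_eq_sub (hB.memLp s) (hB.memLp t), hB.centred s, zero_mul, sub_zero] at h
  rw [L2.inner_def, covFun, ← h]
  refine integral_congr_ae ?_
  filter_upwards [(hB.memLp s).coeFn_toLp, (hB.memLp t).coeFn_toLp] with ω h1 h2
  rw [h1, h2]
  simp [mul_comm]

variable {M : VectorMeasure unitInterval (Lp ℝ 2 P)}

theorem IsFractionalBrownianMotion.inner_toLp_apply (hB : IsFractionalBrownianMotion H B P)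
    (hH : 1 / 2 < H) (hM : ∀ t, M (Set.Icc 0 t) = (hB.memLp t).toLp (B t)) (t : unitInterval)
    {A : Set unitInterval} (hA : MeasurableSet A) :
    inner ℝ ((hB.memLp t).toLp (B t)) (M A) = ∫ u in A, crossDensity H (t, u) := by
  have hi : Integrable fun u => crossDensity H (t, u) :=
    integrable_of_continuous_of_compactSpace _ ((continuous_crossDensity hH).comp (by fun_prop))
  rw [inner_apply_eq_of_primitive hM (μ := volume.withDensityᵥ fun u => crossDensity H (t, u))
    (fun s => ?_) A, withDensityᵥ_apply hi hA]
  rw [withDensityᵥ_apply hi measurableSet_Icc, hB.inner_toLp, setIntegral_crossDensity hH]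

/-- Apply `inner_apply_eq_of_primitive` with `y = M A`: the distribution function is already known
from `inner_toLp_apply`, and Fubini identifies it with an integral of `covDensity`. -/
theorem IsFractionalBrownianMotion.inner_apply_apply (hB : IsFractionalBrownianMotion H B P)
    (hH : 1 / 2 < H) (hM : ∀ t, M (Set.Icc 0 t) = (hB.memLp t).toLp (B t))
    {A D : Set unitInterval} (hA : MeasurableSet A) (hD : MeasurableSet D) :
    inner ℝ (M A) (M D) = ∫ q in A ×ˢ D, covDensity H q := by
  have hprod : ∀ E : Set unitInterval, MeasurableSet E →
      ∫ q in A ×ˢ E, covDensity H q = ∫ v in E, ∫ u in A, covDensity H (u, v) := fun E _ => by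
    have h := (integrable_covDensity hH).integrableOn (s := E ×ˢ A)
    rw [Measure.volume_eq_prod] at h ⊢
    rw [← setIntegral_prod_swap, setIntegral_prod _ ?_]
    · rfl
    · exact h.congr_fun_ae (ae_of_all _ fun q => (covDensity_swap q).symm)
  have hi : Integrable fun v => ∫ u in A, covDensity H (u, v) := by
    have h1 : Integrable (covDensity H) ((volume.restrict A).prod volume) := by
      have h2 := (integrable_covDensity hH).integrableOn (s := A ×ˢ Set.univ)
      rwa [IntegrableOn, Measure.volume_eq_prod, ← Measure.prod_restrict,
        Measure.restrict_univ] at h2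
    exact h1.integral_prod_right
  rw [inner_apply_eq_of_primitive hM
    (μ := volume.withDensityᵥ fun v => ∫ u in A, covDensity H (u, v)) (fun t => ?_) D,
    withDensityᵥ_apply hi hD, hprod D hD]
  rw [withDensityᵥ_apply hi measurableSet_Icc, ← hprod _ measurableSet_Icc, real_inner_comm,
    hB.inner_toLp_apply hH hM t hA, Measure.volume_eq_prod, setIntegral_prod _ (by
      rw [← Measure.volume_eq_prod]; exact (integrable_covDensity hH).integrableOn)]
  simp only [setIntegral_covDensity_section hH]

theorem IsFractionalBrownianMotion.isCentredGaussian_of_mem (hB : IsFractionalBrownianMotion H B P)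
    {w : Lp ℝ 2 P} (hw : w ∈ closedSpan hB.memLp) : IsCentredGaussian P w :=
  isCentredGaussian_of_mem_closedSpan hB.memLp hB.isGaussianProcess hB.centred hw

theorem IsFractionalBrownianMotion.integral_apply (hB : IsFractionalBrownianMotion H B P)
    (hM : ∀ t, M (Set.Icc 0 t) = (hB.memLp t).toLp (B t)) (A : Set unitInterval) :
    ∫ ω, M A ω ∂P = 0 :=
  (hB.isCentredGaussian_of_mem (apply_mem_closedSpan_of_primitive hM A)).integral_eq_zero

theorem covariance_eq_inner {w z : Lp ℝ 2 P} :
    cov[w, z; P] = inner ℝ w z - (∫ ω, w ω ∂P) * ∫ ω, z ω ∂P := by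
  rw [covariance_eq_sub (Lp.memLp w) (Lp.memLp z), L2.inner_def]
  congr 2
  ext ω
  simp [mul_comm]

theorem IsFractionalBrownianMotion.cov_apply_apply (hB : IsFractionalBrownianMotion H B P)
    (hH : 1 / 2 < H) (hM : ∀ t, M (Set.Icc 0 t) = (hB.memLp t).toLp (B t))
    {A D : Set unitInterval} (hA : MeasurableSet A) (hD : MeasurableSet D) :
    cov[M A, M D; P] = ∫ q in A ×ˢ D, covDensity H q := by
  rw [covariance_eq_inner, hB.integral_apply hM, zero_mul, sub_zero,
    hB.inner_apply_apply hH hM hA hD]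

theorem isCovarianceMeasure_withDensity (hB : IsFractionalBrownianMotion H B P)
    (hH : 1 / 2 < H) (hM : ∀ t, M (Set.Icc 0 t) = (hB.memLp t).toLp (B t)) :
    IsCovarianceMeasure P M (volume.withDensityᵥ (covDensity H)) := fun A D hA hD => by
  rw [hB.cov_apply_apply hH hM hA hD, withDensityᵥ_apply (integrable_covDensity hH) (hA.prod hD)]

theorem IsFractionalBrownianMotion.crossCovKernel_eq (hB : IsFractionalBrownianMotion H B P)
    (hH : 1 / 2 < H) (hM : ∀ t, M (Set.Icc 0 t) = (hB.memLp t).toLp (B t)) (t : unitInterval)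
    {A : Set unitInterval} (hA : MeasurableSet A) :
    crossCovKernel P B hB.memLp M t A = ∫ u in A, crossDensity H (t, u) := by
  rw [crossCovKernel_apply, ← hB.inner_toLp_apply hH hM t hA,
    covariance_eq_sub (hB.memLp t) (Lp.memLp (M A)), hB.centred t, zero_mul, sub_zero,
    L2.inner_def]
  refine integral_congr_ae ?_
  filter_upwards [(hB.memLp t).coeFn_toLp] with ω h1
  rw [h1]
  simp [mul_comm]

end FractionalBrownianMotion

section DensityKernel

variable {H : ℝ} {K : unitInterval → SignedMeasure unitInterval}

/-- A product of signed measures is determined by its values on rectangles, where the integral of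
the product density factorises. -/
theorem secondOrderKernel_eq_of_density (hH : 1 / 2 < H)
    (hK : ∀ t A, MeasurableSet A → K t A = ∫ u in A, crossDensity H (t, u))
    (p : unitInterval × unitInterval) {E : Set (unitInterval × unitInterval)}
    (hE : MeasurableSet E) :
    secondOrderKernel K p E = ∫ q in E, crossDensity H (p.2, q.1) * crossDensity H (p.1, q.2) := by
  have hc := continuous_crossDensity hH
  have hi : Integrable fun q : unitInterval × unitInterval =>
      crossDensity H (p.2, q.1) * crossDensity H (p.1, q.2) :=
    integrable_of_continuous_of_compactSpace _ ((hc.comp (by fun_prop)).mul (hc.comp (by fun_prop)))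
  rw [secondOrderKernel, VectorMeasure.prod_eq_of_forall_apply_prod
    (ρ := volume.withDensityᵥ fun q : unitInterval × unitInterval =>
      crossDensity H (p.2, q.1) * crossDensity H (p.1, q.2)) fun A D hA hD => ?_,
    withDensityᵥ_apply hi hE]
  rw [withDensityᵥ_apply hi (hA.prod hD), Measure.volume_eq_prod,
    setIntegral_prod_mul (fun u => crossDensity H (p.2, u)) (fun v => crossDensity H (p.1, v)),
    hK _ _ hA, hK _ _ hD]
  rfl

theorem isCfmKernel_of_density (hH : 1 / 2 < H)
    (hK : ∀ t A, MeasurableSet A → K t A = ∫ u in A, crossDensity H (t, u)) : IsCfmKernel K := by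
  intro A hA
  simp only [hK _ A hA]
  exact continuous_setIntegral_of_continuous _ (continuous_crossDensity hH) A

theorem isCfmKernel_secondOrderKernel_of_density (hH : 1 / 2 < H)
    (hK : ∀ t A, MeasurableSet A → K t A = ∫ u in A, crossDensity H (t, u)) :
    IsCfmKernel (secondOrderKernel K) := by
  intro E hE
  have hc := continuous_crossDensity hH
  simp only [secondOrderKernel_eq_of_density hH hK _ hE]
  exact continuous_setIntegral_of_continuous _
    (G := fun x : (unitInterval × unitInterval) × (unitInterval × unitInterval) =>
      crossDensity H (x.1.2, x.2.1) * crossDensity H (x.1.1, x.2.2))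
    ((hc.comp (by fun_prop)).mul (hc.comp (by fun_prop))) E

theorem isSelfIntegral_of_density (hH : 1 / 2 < H)
    (hK : ∀ t A, MeasurableSet A → K t A = ∫ u in A, crossDensity H (t, u))
    (D : Set unitInterval) : IsSelfIntegral K D (∫ u in D, crossDensity H (u, u)) := by
  intro R
  simp only [hK _ _ (R.measurableSet_part _ _)]
  exact R.tendsto_sum_setIntegral volume (continuous_crossDensity hH)

theorem isQuasiSelfIntegral_of_density (hH : 1 / 2 < H)
    (hK : ∀ t A, MeasurableSet A → K t A = ∫ u in A, crossDensity H (t, u))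
    (A D : Set unitInterval) : IsQuasiSelfIntegral (secondOrderKernel K) A D
      (∫ q in A ×ˢ D, crossDensity H q.swap * crossDensity H q) := by
  intro R S
  have hc := continuous_crossDensity hH
  simp only [secondOrderKernel_eq_of_density hH hK _
    ((R.measurableSet_part _ _).prod (S.measurableSet_part _ _))]
  exact R.tendsto_sum_sum_setIntegral S volume
    (G := fun x : (unitInterval × unitInterval) × (unitInterval × unitInterval) =>
      crossDensity H (x.1.2, x.2.1) * crossDensity H (x.1.1, x.2.2))
    ((hc.comp (by fun_prop)).mul (hc.comp (by fun_prop)))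

end DensityKernel

/-- Uniqueness of `ℓ` rests on the existence of a Riemann system of `D`; otherwise every number
would qualify. -/
theorem IsSelfIntegral.selfIntegrable {K : unitInterval → SignedMeasure unitInterval}
    {D : Set unitInterval} (hD : MeasurableSet D) {ℓ : ℝ} (h : IsSelfIntegral K D ℓ) :
    SelfIntegrable K D := by
  obtain ⟨R⟩ := nonempty_riemannSystem hD
  exact ⟨ℓ, h, fun ℓ' h' => tendsto_nhds_unique (h' R) (h R)⟩

theorem IsQuasiSelfIntegral.quasiSelfIntegrable
    {L : unitInterval × unitInterval → SignedMeasure (unitInterval × unitInterval)}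
    {A D : Set unitInterval} (hA : MeasurableSet A) (hD : MeasurableSet D) {ℓ : ℝ}
    (h : IsQuasiSelfIntegral L A D ℓ) : QuasiSelfIntegrable L A D := by
  obtain ⟨R⟩ := nonempty_riemannSystem hA
  obtain ⟨S⟩ := nonempty_riemannSystem hD
  exact ⟨ℓ, h, fun ℓ' h' => tendsto_nhds_unique (h' R S) (h R S)⟩

end

section

/-! ### Uniqueness of the derivative random measure -/

section Uniqueness

theorem signedMeasure_apply_eq_sub {X : Type*} [MeasurableSpace X] (ν : SignedMeasure X)
    {A : Set X} (hA : MeasurableSet A) :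
    ν A = ν.toJordanDecomposition.posPart.real A - ν.toJordanDecomposition.negPart.real A := by
  conv_lhs => rw [← ν.toSignedMeasure_toJordanDecomposition]
  rw [JordanDecomposition.toSignedMeasure, _root_.sub_apply,
    Measure.toSignedMeasure_apply_measurable hA, Measure.toSignedMeasure_apply_measurable hA]

theorem RiemannSystem.tendsto_sum_mul {X : Type*} [PseudoMetricSpace X] [MeasurableSpace X]
    [CompactSpace X] [BorelSpace X] {D : Set X} (R : RiemannSystem D) (ρ : Measure X)
    [IsFiniteMeasure ρ] {f : X → ℝ} (hf : Continuous f) :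
    Tendsto (fun n => ∑ j, f (R.tag n j) * ρ.real (R.part n j)) atTop (𝓝 (∫ y in D, f y ∂ρ)) := by
  have h := R.tendsto_sum_setIntegral ρ (G := fun q => f q.1) (hf.comp continuous_fst)
  simpa [setIntegral_const, mul_comm] using h

/-- Identifies limits of Riemann sums with integrals against the Jordan parts, to which dominated
convergence applies. -/
theorem RiemannSystem.tendsto_sum_mul_signedMeasure {X : Type*} [PseudoMetricSpace X]
    [MeasurableSpace X] [CompactSpace X] [BorelSpace X] (R : RiemannSystem (Set.univ : Set X))
    (ν : SignedMeasure X) {f : X → ℝ} (hf : Continuous f) :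
    Tendsto (fun n => ∑ j, f (R.tag n j) * ν (R.part n j)) atTop
      (𝓝 (∫ y, f y ∂ν.toJordanDecomposition.posPart -
        ∫ y, f y ∂ν.toJordanDecomposition.negPart)) := by
  have h := (R.tendsto_sum_mul ν.toJordanDecomposition.posPart hf).sub
    (R.tendsto_sum_mul ν.toJordanDecomposition.negPart hf)
  rw [setIntegral_univ, setIntegral_univ] at h
  refine h.congr fun n => ?_
  rw [← Finset.sum_sub_distrib]
  refine Finset.sum_congr rfl fun j _ => ?_
  rw [signedMeasure_apply_eq_sub ν (R.measurableSet_part n j)]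
  ring

/-- Smooth functions with compact support in `(0, 1)` approximating the indicator of `(0, b)`. -/
theorem exists_smooth_tendsto_indicator_Ioo {b : ℝ} (hb : 0 < b) (hb1 : b ≤ 1) :
    ∃ φ : ℕ → ℝ → ℝ, (∀ n, ContDiff ℝ ((⊤ : ℕ∞) : WithTop ℕ∞) (φ n)) ∧
      (∀ n, HasCompactSupport (φ n)) ∧ (∀ n, tsupport (φ n) ⊆ Set.Ioo 0 1) ∧
      (∀ n x, |φ n x| ≤ 1) ∧
      ∀ x, Tendsto (fun n => φ n x) atTop (𝓝 ((Set.Ioo 0 b).indicator (fun _ => (1 : ℝ)) x)) := by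
  -- Bumps centred at `b / 2` with both radii increasing to `b / 2`. The shift by `3` keeps the
  -- inner radius positive at `n = 0`.
  have hr : ∀ n : ℕ, 0 < b / 2 * (1 - 2 / ((n : ℝ) + 3)) := fun n => by
    have : 2 / ((n : ℝ) + 3) < 1 := by
      rw [div_lt_one (by positivity)]
      have : (0 : ℝ) ≤ n := n.cast_nonneg
      linarith
    exact mul_pos (by linarith) (by linarith)
  have hlt : ∀ n : ℕ, b / 2 * (1 - 2 / ((n : ℝ) + 3)) < b / 2 * (1 - 1 / ((n : ℝ) + 3)) := fun n => by
    have : 1 / ((n : ℝ) + 3) < 2 / ((n : ℝ) + 3) := by gcongr; norm_num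
    nlinarith
  have hout : ∀ n : ℕ, b / 2 * (1 - 1 / ((n : ℝ) + 3)) < b / 2 := fun n => by
    have : 0 < 1 / ((n : ℝ) + 3) := by positivity
    nlinarith
  let f : (n : ℕ) → ContDiffBump (b / 2) := fun n => ⟨_, _, hr n, hlt n⟩
  refine ⟨fun n => f n, fun n => (f n).contDiff, fun n => (f n).hasCompactSupport, fun n x hx => ?_,
    fun n x => by rw [abs_of_nonneg (f n).nonneg]; exact (f n).le_one, fun x => ?_⟩
  · rw [(f n).tsupport_eq, Metric.mem_closedBall, Real.dist_eq, abs_le] at hx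
    have := hout n
    change _ ≤ _ ∧ _ ≤ b / 2 * (1 - 1 / ((n : ℝ) + 3)) at hx
    change -(b / 2 * (1 - 1 / ((n : ℝ) + 3))) ≤ _ ∧ _ at hx
    constructor <;> linarith [hx.1, hx.2]
  · by_cases hx : x ∈ Set.Ioo 0 b
    · rw [Set.indicator_of_mem hx]
      have hlim : Tendsto (fun n : ℕ => b / 2 * (1 - 2 / ((n : ℝ) + 3))) atTop
          (𝓝 (b / 2 * (1 - 0))) := by
        refine Tendsto.const_mul _ (Tendsto.const_sub _ ?_)
        exact tendsto_const_nhds.div_atTop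
          (tendsto_atTop_add_const_right _ _ tendsto_natCast_atTop_atTop)
      have hx' : |x - b / 2| < b / 2 * (1 - 0) := by
        rw [abs_lt]; constructor <;> linarith [hx.1, hx.2]
      refine tendsto_const_nhds.congr' ?_
      filter_upwards [hlim.eventually_const_lt hx'] with n hn
      refine ((f n).one_of_mem_closedBall ?_).symm
      rw [Metric.mem_closedBall, Real.dist_eq]
      exact hn.le
    · rw [Set.indicator_of_notMem hx]
      refine tendsto_const_nhds.congr fun n => ((f n).zero_of_le_dist ?_).symm
      rw [Real.dist_eq]
      refine (hout n).le.trans ?_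
      by_contra! hlt
      rw [abs_lt] at hlt
      exact hx ⟨by linarith, by linarith⟩

/-- A signed measure on `[0,1]` that vanishes on test functions and does not charge the endpoints
is zero. -/
theorem signedMeasure_eq_zero_of_smooth {ν : SignedMeasure unitInterval}
    (h : ∀ φ : ℝ → ℝ, ContDiff ℝ ((⊤ : ℕ∞) : WithTop ℕ∞) φ → HasCompactSupport φ →
      tsupport φ ⊆ Set.Ioo 0 1 → ∀ R : RiemannSystem (Set.univ : Set unitInterval),
        Tendsto (fun n => ∑ j, φ (R.tag n j) * ν (R.part n j)) atTop (𝓝 0))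
    (h0 : ν {0} = 0) (h1 : ν {1} = 0) : ν = 0 := by
  obtain ⟨R⟩ := nonempty_riemannSystem (MeasurableSet.univ : MeasurableSet (Set.univ : Set unitInterval))
  have hIoo : ∀ b : unitInterval, ν (Set.Ioo 0 b) = 0 := by
    intro b
    rcases eq_or_lt_of_le (unitInterval.nonneg' (t := b)) with hb | hb
    · simp [← hb]
    obtain ⟨φ, hs, hc, ht, hle, hlim⟩ := exists_smooth_tendsto_indicator_Ioo
      (b := b) hb b.2.2
    have hind : ∀ x : unitInterval, (Set.Ioo (0 : ℝ) b).indicator (fun _ => (1 : ℝ)) x =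
        (Set.Ioo 0 b).indicator (fun _ => (1 : ℝ)) x := fun x => by
      by_cases hx : x ∈ Set.Ioo 0 b
      · rw [Set.indicator_of_mem hx, Set.indicator_of_mem (show (x : ℝ) ∈ Set.Ioo 0 (b : ℝ) from ⟨hx.1, hx.2⟩)]
      · rw [Set.indicator_of_notMem hx, Set.indicator_of_notMem fun hx' => hx ⟨hx'.1, hx'.2⟩]
    have hD : ∀ ρ : Measure unitInterval, IsFiniteMeasure ρ →
        Tendsto (fun n => ∫ x : unitInterval, φ n x ∂ρ) atTop (𝓝 (ρ.real (Set.Ioo 0 b))) := by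
      intro ρ _
      have := tendsto_integral_of_dominated_convergence (μ := ρ)
        (F := fun n (x : unitInterval) => φ n x) (fun _ => (1 : ℝ))
        (fun n => Continuous.aestronglyMeasurable
          ((hs n).continuous.comp continuous_subtype_val))
        (integrable_const _) (fun n => Eventually.of_forall fun x : unitInterval => hle n x)
        (Eventually.of_forall fun x : unitInterval => hlim x)
      simpa only [hind, integral_indicator_const (1 : ℝ) measurableSet_Ioo, smul_eq_mul,
        mul_one] using this
    have hzero : ∀ n, ∫ x : unitInterval, φ n x ∂ν.toJordanDecomposition.posPart -
        ∫ x : unitInterval, φ n x ∂ν.toJordanDecomposition.negPart = 0 := fun n =>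
      tendsto_nhds_unique (R.tendsto_sum_mul_signedMeasure ν (f := fun x => φ n x)
        ((hs n).continuous.comp continuous_subtype_val)) (h _ (hs n) (hc n) (ht n) R)
    rw [signedMeasure_apply_eq_sub ν measurableSet_Ioo]
    refine tendsto_nhds_unique ((hD _ inferInstance).sub (hD _ inferInstance)) ?_
    simp only [hzero]
    exact tendsto_const_nhds
  -- The sets `[0,b) = {0} ∪ (0,b)` form a generating π-system. The hypothesis at `1` enters through
  -- the total mass.
  refine VectorMeasure.ext_of_generateFrom (Set.range Set.Iio) ?_ ?_ isPiSystem_Iio ?_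
  · rintro _ ⟨b, rfl⟩
    rcases eq_or_lt_of_le (unitInterval.nonneg' (t := b)) with hb | hb
    · have : Set.Iio b = ∅ := by
        ext x; simp [← hb]
      simp [this]
    · have : Set.Iio b = {0} ∪ Set.Ioo 0 b := by
        ext x
        rcases eq_or_lt_of_le (unitInterval.nonneg' (t := x)) with hx | hx
        · simp [← hx, hb]
        · simp [hx, hx.ne']
      rw [this, VectorMeasure.of_union (by simp) (measurableSet_singleton _) measurableSet_Ioo, h0,
        hIoo]
      simp
  · rw [← borel_eq_generateFrom_Iio]
    exact BorelSpace.measurable_eq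
  · have : (Set.univ : Set unitInterval) = ({0} ∪ Set.Ioo 0 1) ∪ {1} := by
      ext x
      rcases eq_or_lt_of_le (unitInterval.nonneg' (t := x)) with hx | hx
      · simp [← hx]
      · rcases eq_or_lt_of_le (unitInterval.le_one' (t := x)) with hx1 | hx1
        · simp [hx1]
        · simpa [hx] using hx1.le
    rw [this, VectorMeasure.of_union (by simp) ((measurableSet_singleton _).union measurableSet_Ioo)
      (measurableSet_singleton _), VectorMeasure.of_union (by simp) (measurableSet_singleton _)
      measurableSet_Ioo, h0, hIoo, h1]
    simp

variable {Ω : Type*} [MeasurableSpace Ω] {P : Measure Ω}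

theorem tendsto_eLpNorm_sub_iff {f : ℕ → Ω → ℝ} {F : ℕ → Lp ℝ 2 P} (h : ∀ n, F n =ᵐ[P] f n)
    (Y : Lp ℝ 2 P) :
    Tendsto (fun n => eLpNorm (fun ω => f n ω - Y ω) 2 P) atTop (𝓝 0) ↔
      Tendsto F atTop (𝓝 Y) := by
  rw [Lp.tendsto_Lp_iff_tendsto_eLpNorm']
  refine tendsto_congr fun n => eLpNorm_congr_ae ?_
  filter_upwards [h n] with ω hω
  simp [hω]

theorem isStochIntegral_deterministic_iff {X : Type*} [PseudoEMetricSpace X] [MeasurableSpace X]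
    {f : X → ℝ} {M : VectorMeasure X (Lp ℝ 2 P)} {D : Set X} {Y : Lp ℝ 2 P} :
    IsStochIntegral 2 P (fun t _ => f t) M D Y ↔ ∀ R : RiemannSystem D,
      Tendsto (fun n => ∑ j, f (R.tag n j) • M (R.part n j)) atTop (𝓝 Y) := by
  refine forall_congr' fun R => tendsto_eLpNorm_sub_iff (fun n => ?_) Y
  have h1 : ∀ j ∈ Finset.univ, ((f (R.tag n j) • M (R.part n j) : Lp ℝ 2 P) : Ω → ℝ) =ᵐ[P]
      fun ω => f (R.tag n j) * (M (R.part n j) : Ω → ℝ) ω := fun j _ =>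
    Lp.coeFn_smul _ _
  filter_upwards [Lp.coeFn_finsetSum Finset.univ fun j => f (R.tag n j) • M (R.part n j),
    (Finset.eventually_all _).2 h1] with ω h h'
  rw [h, Finset.sum_apply]
  exact Finset.sum_congr rfl h'

/-- Testing against an arbitrary `y` reduces the claim to signed measures. The endpoint conditions
exclude point masses that test functions on `(0,1)` cannot detect. -/
theorem IsDerivativeRandomMeasure.eq {Z : unitInterval → Ω → ℝ} {hZ : ∀ t, MemLp (Z t) 2 P}
    {M M' : VectorMeasure unitInterval (Lp ℝ 2 P)} (h : IsDerivativeRandomMeasure P Z hZ M)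
    (h' : IsDerivativeRandomMeasure P Z hZ M') : M = M' := by
  have key : ∀ y : Lp ℝ 2 P, testMeasure M y - testMeasure M' y = 0 := fun y => by
    refine signedMeasure_eq_zero_of_smooth (fun φ hs hc ht R => ?_) ?_ ?_
    · have h1 := isStochIntegral_deterministic_iff.1 (h.isDistributionalDerivative φ hs hc ht) R
      have h2 := isStochIntegral_deterministic_iff.1 (h'.isDistributionalDerivative φ hs hc ht) R
      have h3 := ((innerSL ℝ y).continuous.tendsto _).comp (h1.sub h2)
      rw [sub_self, map_zero] at h3
      refine h3.congr fun n => ?_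
      simp only [Function.comp_apply, map_sub, map_sum, map_smul, ← Finset.sum_sub_distrib,
        _root_.sub_apply, testMeasure_apply, smul_eq_mul, mul_sub]
      rfl
    · simp [testMeasure_apply, h.zero_endpoint, h'.zero_endpoint]
    · simp [testMeasure_apply, h.one_endpoint, h'.one_endpoint]
  refine VectorMeasure.ext fun A _ => ext_inner_left ℝ fun y => ?_
  rw [← testMeasure_apply, ← testMeasure_apply, sub_eq_zero.1 (key y)]

end Uniqueness

end

section

/-! ### Indicators in `L²([0,1])` -/

section IndicatorMeasure

/-- The indicator function of a Borel set of `[0,1]` as an element of `L²([0,1])`. -/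
noncomputable abbrev indLp {A : Set unitInterval} (hA : MeasurableSet A) :
    Lp ℝ 2 (volume : Measure unitInterval) :=
  indicatorConstLp 2 hA (measure_ne_top volume A) (1 : ℝ)

/-- The Gram matrix of indicators is `|A ∩ D|`, the mass of `A ×ˢ D` under the image of Lebesgue
measure on the diagonal. -/
theorem exists_indicatorMeasure :
    ∃ V : VectorMeasure unitInterval (Lp ℝ 2 (volume : Measure unitInterval)),
      ∀ A (hA : MeasurableSet A), V A = indLp hA := by
  classical
  have hdiag : Measurable fun x : unitInterval => (x, x) := measurable_id.prodMk measurable_id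
  obtain ⟨V, hV⟩ := exists_vectorMeasure_of_inner
    (N := fun A : Set unitInterval => if hA : MeasurableSet A then indLp hA else 0)
    (ρ := (volume : Measure unitInterval).map fun x => (x, x)) (fun A D hA hD => by
      simp only [hA, hD, dif_pos]
      rw [L2.real_inner_indicatorConstLp_one_indicatorConstLp_one, measureReal_def,
        measureReal_def, Measure.map_apply hdiag (hA.prod hD)]
      rfl)
  exact ⟨V, fun A hA => by rw [hV A hA, dif_pos hA]⟩

theorem eq_zero_of_setIntegral_Icc {z : unitInterval → ℝ} (hz : Integrable z)
    (h : ∀ t, ∫ x in Set.Icc 0 t, z x = 0) : z =ᵐ[volume] 0 := by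
  refine hz.ae_eq_of_withDensityᵥ_eq (integrable_zero _ _ _) ?_
  rw [withDensityᵥ_zero]
  refine vectorMeasure_ext_Icc fun t => ?_
  rw [withDensityᵥ_apply hz measurableSet_Icc, h]
  rfl

/-- Finite linear combinations of the indicators of `[0,t]`. -/
noncomputable def stepLp : (unitInterval →₀ ℝ) →ₗ[ℝ] Lp ℝ 2 (volume : Measure unitInterval) :=
  Finsupp.linearCombination ℝ fun t => indLp (measurableSet_Icc (a := (0 : unitInterval)) (b := t))

theorem integrable_Lp_two {X : Type*} [MeasurableSpace X] {ρ : Measure X} [IsFiniteMeasure ρ]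
    (z : Lp ℝ 2 ρ) : Integrable z ρ :=
  (Lp.memLp z).integrable (by norm_num)

/-- A function orthogonal to all indicators of `[0,t]` has vanishing primitive and hence is zero
almost everywhere. -/
theorem denseRange_stepLp : DenseRange stepLp := by
  have h : (LinearMap.range stepLp).topologicalClosure = ⊤ := by
    rw [Submodule.topologicalClosure_eq_top_iff, Submodule.eq_bot_iff]
    intro z hz
    rw [stepLp, Finsupp.range_linearCombination, Submodule.mem_orthogonal] at hz
    refine Lp.ext ((eq_zero_of_setIntegral_Icc (integrable_Lp_two z) fun t => ?_).trans
      (Lp.coeFn_zero ℝ 2 _).symm)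
    rw [← L2.inner_indicatorConstLp_one measurableSet_Icc (measure_ne_top volume _)]
    exact hz _ (Submodule.subset_span ⟨t, rfl⟩)
  have h2 := Submodule.dense_iff_topologicalClosure_eq_top.2 h
  exact h2

end IndicatorMeasure

/-! ### The Schur test -/

section Schur

variable {H : ℝ}

theorem covFun_comm (s t : unitInterval) : covFun H (s, t) = covFun H (t, s) := by
  rw [covFun, covFun, abs_sub_comm, add_comm (|(s : ℝ)| ^ (2 * H))]

theorem setIntegral_covDensity_Icc_prod (hH : 1 / 2 < H) (s t : unitInterval) :
    ∫ q in Set.Icc 0 s ×ˢ Set.Icc 0 t, covDensity H q = covFun H (s, t) := by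
  rw [Measure.volume_eq_prod, setIntegral_prod _ (by
    rw [← Measure.volume_eq_prod]; exact (integrable_covDensity hH).integrableOn)]
  simp only [setIntegral_covDensity_section hH]
  rw [setIntegral_crossDensity hH, covFun_comm]

/-- Schur test for a symmetric nonnegative kernel: bound `g(u) g(v)` by `(g(u)² + g(v)²) / 2` and
use the uniform bound `2H` on the section integrals. -/
theorem integral_quadratic_covDensity_le (hH : 1 / 2 < H) {g : unitInterval → ℝ}
    (hg : Measurable g) {C : ℝ} (hC : ∀ u, |g u| ≤ C) :
    ∫ q : unitInterval × unitInterval, g q.1 * g q.2 * covDensity H q ≤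
      2 * H * ∫ u, g u ^ 2 := by
  have hk := integrable_covDensity hH
  have hC0 : 0 ≤ C := (abs_nonneg _).trans (hC 0)
  have hsq : ∀ u, |g u ^ 2| ≤ C ^ 2 := fun u => by
    rw [abs_pow]; exact pow_le_pow_left₀ (abs_nonneg _) (hC u) 2
  have hi1 : Integrable fun q : unitInterval × unitInterval => g q.1 ^ 2 * covDensity H q :=
    hk.bdd_mul (c := C ^ 2) ((hg.comp measurable_fst).pow_const 2).aestronglyMeasurable
      (Eventually.of_forall fun q => hsq _)
  have hi2 : Integrable fun q : unitInterval × unitInterval => g q.2 ^ 2 * covDensity H q :=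
    hk.bdd_mul (c := C ^ 2) ((hg.comp measurable_snd).pow_const 2).aestronglyMeasurable
      (Eventually.of_forall fun q => hsq _)
  have hi : Integrable fun q : unitInterval × unitInterval => g q.1 * g q.2 * covDensity H q :=
    hk.bdd_mul (c := C * C) ((hg.comp measurable_fst).mul
      (hg.comp measurable_snd)).aestronglyMeasurable (Eventually.of_forall fun q => by
        rw [Real.norm_eq_abs, abs_mul]
        exact mul_le_mul (hC _) (hC _) (abs_nonneg _) hC0)
  have hswap : ∫ q : unitInterval × unitInterval, g q.2 ^ 2 * covDensity H q =
      ∫ q : unitInterval × unitInterval, g q.1 ^ 2 * covDensity H q := by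
    have := integral_prod_swap (μ := (volume : Measure unitInterval))
      (ν := (volume : Measure unitInterval))
      (fun q : unitInterval × unitInterval => g q.1 ^ 2 * covDensity H q)
    simpa only [Prod.fst_swap, covDensity_swap, ← Measure.volume_eq_prod] using this
  have hfirst : ∫ q : unitInterval × unitInterval, g q.1 ^ 2 * covDensity H q ≤
      2 * H * ∫ u, g u ^ 2 := by
    have hi1' := hi1
    rw [Measure.volume_eq_prod] at hi1' ⊢
    rw [integral_prod _ hi1', ← integral_const_mul]
    refine integral_mono hi1'.integral_prod_left ?_ fun u => ?_
    · exact (Integrable.of_bound (C := C ^ 2) (hg.pow_const 2).aestronglyMeasurable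
        (Eventually.of_forall hsq)).const_mul _
    · simp only [integral_const_mul]
      rw [mul_comm (2 * H)]
      exact mul_le_mul_of_nonneg_left (integral_covDensity_section_le hH u) (sq_nonneg _)
  calc ∫ q : unitInterval × unitInterval, g q.1 * g q.2 * covDensity H q
      ≤ ∫ q : unitInterval × unitInterval,
          (1 / 2) * (g q.1 ^ 2 * covDensity H q + g q.2 ^ 2 * covDensity H q) := by
        refine integral_mono hi ((hi1.add hi2).const_mul _) fun q => ?_
        have := mul_nonneg (sq_nonneg (g q.1 - g q.2)) (covDensity_nonneg hH q)
        simp only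
        nlinarith
    _ = ∫ q : unitInterval × unitInterval, g q.1 ^ 2 * covDensity H q := by
        rw [integral_const_mul, integral_add hi1 hi2, hswap]
        ring
    _ ≤ _ := hfirst

/-- The left side is the quadratic form of `covDensity` at the step function `stepLp c`, because
`covFun` is the mass of a rectangle; it is also the squared norm of `∑ c t • B t`. -/
theorem sum_sum_covFun_le (hH : 1 / 2 < H) (c : unitInterval →₀ ℝ) :
    ∑ s ∈ c.support, ∑ t ∈ c.support, c s * c t * covFun H (s, t) ≤ 2 * H * ‖stepLp c‖ ^ 2 := by
  let χ : unitInterval → unitInterval → ℝ := fun t => (Set.Icc 0 t).indicator fun _ => 1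
  let g : unitInterval → ℝ := fun u => ∑ t ∈ c.support, c t * χ t u
  have hχ : ∀ t, Measurable (χ t) := fun t => measurable_const.indicator measurableSet_Icc
  have hg : Measurable g := Finset.measurable_sum _ fun t _ => (hχ t).const_mul _
  have hbound : ∀ u, |g u| ≤ ∑ t ∈ c.support, |c t| := fun u => by
    refine (Finset.abs_sum_le_sum_abs _ _).trans (Finset.sum_le_sum fun t _ => ?_)
    rw [abs_mul]
    refine mul_le_of_le_one_right (abs_nonneg _) ?_
    simp only [χ, Set.indicator]
    split_ifs <;> simp
  have hcoe : (stepLp c : unitInterval → ℝ) =ᵐ[volume] g := by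
    have h1 : ∀ t ∈ c.support, ((c t • indLp (measurableSet_Icc (a := 0) (b := t)) :
        Lp ℝ 2 (volume : Measure unitInterval)) : unitInterval → ℝ) =ᵐ[volume]
        fun u => c t * χ t u := fun t _ => by
      filter_upwards [Lp.coeFn_smul (c t) (indLp (measurableSet_Icc (a := 0) (b := t))),
        indicatorConstLp_coeFn (p := 2) (hs := measurableSet_Icc (a := 0) (b := t))
          (hμs := measure_ne_top volume _) (c := (1 : ℝ))] with u h h'
      rw [h, Pi.smul_apply, h', smul_eq_mul]
    filter_upwards [Lp.coeFn_finsetSum c.support fun t =>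
      c t • indLp (measurableSet_Icc (a := 0) (b := t)),
      (Finset.eventually_all _).2 h1] with u h h'
    rw [stepLp, Finsupp.linearCombination_apply, Finsupp.sum, h, Finset.sum_apply]
    exact Finset.sum_congr rfl h'
  have hnorm : ‖stepLp c‖ ^ 2 = ∫ u, g u ^ 2 := by
    rw [← integral_sq_eq_norm_sq]
    refine integral_congr_ae ?_
    filter_upwards [hcoe] with u hu
    rw [hu]
  have hk := integrable_covDensity hH
  have hint : ∀ s t, Integrable fun q : unitInterval × unitInterval =>
      (Set.Icc 0 s ×ˢ Set.Icc 0 t).indicator (covDensity H) q := fun s t =>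
    hk.indicator (measurableSet_Icc.prod measurableSet_Icc)
  have hexp : ∫ q : unitInterval × unitInterval, g q.1 * g q.2 * covDensity H q =
      ∑ s ∈ c.support, ∑ t ∈ c.support, c s * c t * covFun H (s, t) := by
    have h1 : ∀ q : unitInterval × unitInterval, g q.1 * g q.2 * covDensity H q =
        ∑ s ∈ c.support, ∑ t ∈ c.support,
          c s * c t * (Set.Icc 0 s ×ˢ Set.Icc 0 t).indicator (covDensity H) q := fun q => by
      simp only [g]
      rw [Finset.sum_mul_sum, Finset.sum_mul]
      refine Finset.sum_congr rfl fun s _ => ?_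
      rw [Finset.sum_mul]
      refine Finset.sum_congr rfl fun t _ => ?_
      simp only [χ, Set.indicator, Set.mem_prod]
      split_ifs <;> simp_all
    simp only [h1]
    rw [integral_finsetSum _ fun s _ => integrable_finsetSum _ fun t _ =>
      (hint s t).const_mul _]
    refine Finset.sum_congr rfl fun s _ => ?_
    rw [integral_finsetSum _ fun t _ => (hint s t).const_mul _]
    refine Finset.sum_congr rfl fun t _ => ?_
    rw [integral_const_mul, integral_indicator (measurableSet_Icc.prod measurableSet_Icc),
      setIntegral_covDensity_Icc_prod hH]
  rw [← hexp, hnorm]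
  exact integral_quadratic_covDensity_le hH hg hbound

end Schur

/-! ### The Wiener integral as a bounded operator -/

section WienerIntegral

variable {Ω : Type*} [MeasurableSpace Ω] {P : Measure Ω} [IsProbabilityMeasure P] {H : ℝ}
  {B : unitInterval → Ω → ℝ}

/-- The Wiener integral with respect to fractional Brownian motion with `1/2 < H`, as a bounded
operator on `L²([0,1])`. -/
theorem IsFractionalBrownianMotion.exists_wienerIntegral
    (hB : IsFractionalBrownianMotion H B P) (hH : 1 / 2 < H) :
    ∃ Λ : Lp ℝ 2 (volume : Measure unitInterval) →L[ℝ] Lp ℝ 2 P,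
      ∀ t, Λ (indLp (measurableSet_Icc (a := 0) (b := t))) = (hB.memLp t).toLp (B t) := by
  let f : (unitInterval →₀ ℝ) →ₗ[ℝ] Lp ℝ 2 P :=
    Finsupp.linearCombination ℝ fun t => (hB.memLp t).toLp (B t)
  have hbound : ∀ c, ‖f c‖ ≤ √(2 * H) * ‖stepLp c‖ := fun c => by
    refine le_of_sq_le_sq ?_ (by positivity)
    rw [mul_pow, Real.sq_sqrt (by linarith), ← real_inner_self_eq_norm_sq]
    refine le_trans (le_of_eq ?_) (sum_sum_covFun_le hH c)
    simp only [f, Finsupp.linearCombination_apply, Finsupp.sum, sum_inner, inner_sum,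
      inner_smul_left, inner_smul_right, hB.inner_toLp, conj_trivial]
    refine Finset.sum_congr rfl fun s _ => ?_
    rw [Finset.mul_sum]
    refine Finset.sum_congr rfl fun t _ => ?_
    rw [covFun_comm, mul_assoc]
  -- The bound makes `f` factor through `stepLp`, and density of the step functions extends it to
  -- all of `L²([0,1])`.
  refine ⟨f.extendOfNorm stepLp, fun t => ?_⟩
  have h := LinearMap.extendOfNorm_eq denseRange_stepLp ⟨_, hbound⟩ (Finsupp.single t 1)
  simpa [f, stepLp] using h

theorem IsFractionalBrownianMotion.continuous_toLp (hB : IsFractionalBrownianMotion H B P)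
    (hH : 1 / 2 < H) : Continuous fun t => (hB.memLp t).toLp (B t) := by
  refine continuous_iff_continuousAt.2 fun t => ?_
  rw [ContinuousAt, tendsto_iff_norm_sub_tendsto_zero]
  have hc := continuous_covFun hH
  have h : Tendsto (fun s => √(covFun H (s, s) - 2 * covFun H (s, t) + covFun H (t, t))) (𝓝 t)
      (𝓝 (√(covFun H (t, t) - 2 * covFun H (t, t) + covFun H (t, t)))) := by
    have h2 : Continuous fun s => √(covFun H (s, s) - 2 * covFun H (s, t) + covFun H (t, t)) :=
      ((((hc.comp (by fun_prop)).sub (continuous_const.mul (hc.comp (by fun_prop)))).add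
        continuous_const)).sqrt
    exact h2.tendsto t
  rw [show covFun H (t, t) - 2 * covFun H (t, t) + covFun H (t, t) = 0 by ring,
    Real.sqrt_zero] at h
  refine h.congr fun s => ?_
  rw [← hB.inner_toLp, ← hB.inner_toLp, ← hB.inner_toLp, real_inner_self_eq_norm_sq,
    real_inner_self_eq_norm_sq, ← norm_sub_sq_real, Real.sqrt_sq (norm_nonneg _)]

end WienerIntegral

/-! ### Existence of the derivative random measure -/

section DistributionalDerivative

/-- Integration by parts for a merely integrable `z`, by Fubini on the triangle `x ≤ t`: the
integral of `φ'` over `[x,1]` is `-φ x` because `φ 1 = 0`. -/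
theorem integral_deriv_mul_setIntegral {φ : ℝ → ℝ} (hφ : ContDiff ℝ 1 φ) (h1 : φ 1 = 0)
    {z : unitInterval → ℝ} (hz : Integrable z) :
    ∫ t : unitInterval, deriv φ t * ∫ x in Set.Icc 0 t, z x =
      -∫ x : unitInterval, z x * φ x := by
  have hd : Continuous (deriv φ) := hφ.continuous_deriv le_rfl
  have hdI : Integrable fun t : unitInterval => deriv φ t :=
    integrable_of_continuous_of_compactSpace _ (hd.comp continuous_subtype_val)
  let S : Set (unitInterval × unitInterval) := {q | q.2 ≤ q.1}
  have hS : MeasurableSet S := measurableSet_le measurable_snd measurable_fst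
  have hint : Integrable (S.indicator fun q : unitInterval × unitInterval => deriv φ q.1 * z q.2)
      (volume.prod volume) := (hdI.mul_prod hz).indicator hS
  have hFTC : ∀ x : unitInterval, ∫ t in Set.Icc 0 x, deriv φ t = φ x - φ 0 := fun x => by
    rw [setIntegral_Icc_unitInterval (deriv φ)]
    exact intervalIntegral.integral_deriv_eq_sub
      (fun y _ => (hφ.differentiable one_ne_zero).differentiableAt) (hd.intervalIntegrable _ _)
  have hFTC' : ∀ x : unitInterval, ∫ t in Set.Ici x, deriv φ t = -φ x := fun x => by
    have h2 := integral_add_compl (s := Set.Iio x) measurableSet_Iio hdI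
    have h3 : (Set.Icc 0 1 : Set unitInterval) = Set.univ := by
      ext y; simpa using unitInterval.le_one' (t := y)
    have h4 := hFTC 1
    rw [h3, setIntegral_univ] at h4
    have h5 : ∫ t in Set.Iio x, deriv φ t = φ x - φ 0 := by
      rw [setIntegral_congr_set (Iio_ae_eq_Iic (a := x)), ← hFTC x]
      congr 2
      ext y; simp
    rw [h4, h5, Set.compl_Iio, show ((1 : unitInterval) : ℝ) = 1 from rfl, h1] at h2
    linarith
  calc ∫ t : unitInterval, deriv φ t * ∫ x in Set.Icc 0 t, z x
      = ∫ t : unitInterval, ∫ x : unitInterval,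
          S.indicator (fun q : unitInterval × unitInterval => deriv φ q.1 * z q.2) (t, x) := by
        congr 1
        ext t
        rw [← integral_const_mul, ← integral_indicator measurableSet_Icc]
        congr 1
        ext x
        simp [Set.indicator, S]
    _ = ∫ x : unitInterval, ∫ t : unitInterval,
          S.indicator (fun q : unitInterval × unitInterval => deriv φ q.1 * z q.2) (t, x) :=
        integral_integral_swap hint
    _ = ∫ x : unitInterval, z x * -φ x := by
        congr 1
        ext x
        rw [← hFTC' x, ← integral_const_mul, ← integral_indicator measurableSet_Ici]
        congr 1
        ext t
        simp [Set.indicator, S, mul_comm]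
    _ = -∫ x : unitInterval, z x * φ x := by
        simp only [mul_neg, integral_neg]

/-- Riemann sums of a continuous function converge to it in `L²([0,1])`. -/
theorem RiemannSystem.tendsto_sum_smul_indLp (R : RiemannSystem (Set.univ : Set unitInterval))
    {f : unitInterval → ℝ} (hf : Continuous f) (hf2 : MemLp f 2 volume) :
    Tendsto (fun n => ∑ j, f (R.tag n j) • indLp (R.measurableSet_part n j)) atTop
      (𝓝 (hf2.toLp f)) := by
  rw [Metric.tendsto_nhds]
  intro ε hε
  obtain ⟨δ, hδ, huc⟩ := Metric.uniformContinuous_iff.1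
    (CompactSpace.uniformContinuous_of_continuous hf) (ε / 2) (by positivity)
  filter_upwards [R.eventually_dist_lt hδ] with n hn
  rw [dist_eq_norm]
  refine lt_of_le_of_lt (Lp.norm_le_of_ae_bound (C := ε / 2) (by positivity) ?_) ?_
  · have h1 : ∀ j ∈ Finset.univ, ((f (R.tag n j) • indLp (R.measurableSet_part n j) :
        Lp ℝ 2 (volume : Measure unitInterval)) : unitInterval → ℝ) =ᵐ[volume]
        fun u => f (R.tag n j) * (R.part n j).indicator (fun _ => (1 : ℝ)) u := fun j _ => by
      filter_upwards [Lp.coeFn_smul (f (R.tag n j)) (indLp (R.measurableSet_part n j)),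
        indicatorConstLp_coeFn (p := 2) (hs := R.measurableSet_part n j)
          (hμs := measure_ne_top volume _) (c := (1 : ℝ))] with u h h'
      rw [h, Pi.smul_apply, h', smul_eq_mul]
    filter_upwards [Lp.coeFn_sub (∑ j, f (R.tag n j) • indLp (R.measurableSet_part n j))
      (hf2.toLp f), Lp.coeFn_finsetSum Finset.univ fun j =>
      f (R.tag n j) • indLp (R.measurableSet_part n j),
      (Finset.eventually_all _).2 h1, hf2.coeFn_toLp] with u h2 h3 h4 h5
    rw [h2, Pi.sub_apply, h3, Finset.sum_apply, Finset.sum_congr rfl h4, h5]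
    obtain ⟨j, hj⟩ := Set.mem_iUnion.1 ((R.iUnion_part n).symm ▸ Set.mem_univ u)
    rw [Finset.sum_eq_single j (fun k _ hk => by
      rw [Set.indicator_of_notMem (Set.disjoint_left.1 (R.disjoint_part n hk.symm) hj), mul_zero])
      (fun h => absurd (Finset.mem_univ j) h), Set.indicator_of_mem hj, mul_one, ← dist_eq_norm,
      dist_comm]
    exact (huc (hn j u hj)).le
  · simp only [measureUnivNNReal]
    simp
    linarith

variable {Ω : Type*} [MeasurableSpace Ω] {P : Measure Ω} [IsProbabilityMeasure P] {H : ℝ}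
  {B : unitInterval → Ω → ℝ}

theorem IsFractionalBrownianMotion.exists_isDerivativeRandomMeasure
    (hB : IsFractionalBrownianMotion H B P) (hH : 1 / 2 < H) :
    ∃ M : VectorMeasure unitInterval (Lp ℝ 2 P), IsDerivativeRandomMeasure P B hB.memLp M ∧
      ∀ t, M (Set.Icc 0 t) = (hB.memLp t).toLp (B t) := by
  obtain ⟨V, hV⟩ := exists_indicatorMeasure
  obtain ⟨Λ, hΛ⟩ := hB.exists_wienerIntegral hH
  let M : VectorMeasure unitInterval (Lp ℝ 2 P) :=
    V.mapRange Λ.toLinearMap.toAddMonoidHom Λ.continuous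
  have hMV : ∀ A, M A = Λ (V A) := fun A => rfl
  have hM : ∀ t, M (Set.Icc 0 t) = (hB.memLp t).toLp (B t) := fun t => by
    rw [hMV, hV _ measurableSet_Icc, hΛ]
  have hsing : ∀ x, M {x} = 0 := fun x => by
    rw [hMV, hV _ (measurableSet_singleton x)]
    have : indLp (measurableSet_singleton x) = 0 := by
      rw [← norm_eq_zero, norm_indicatorConstLp (by norm_num) (by norm_num)]
      simp [measureReal_def]
    rw [this, map_zero]
  refine ⟨M, ⟨⟨_, isCovarianceMeasure_withDensity hB hH hM⟩, fun φ hs hc ht => ?_, hsing 0,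
    hsing 1⟩, hM⟩
  rw [isStochIntegral_deterministic_iff (f := fun t : unitInterval => φ t)]
  intro R
  have hφc : Continuous fun t : unitInterval => φ t := hs.continuous.comp continuous_subtype_val
  have hφ2 : MemLp (fun t : unitInterval => φ t) 2 volume :=
    hφc.memLp_of_hasCompactSupport (HasCompactSupport.of_compactSpace _)
  have hs1 : ContDiff ℝ 1 φ := hs.of_le (by exact_mod_cast le_top)
  have hd : Continuous fun t : unitInterval => deriv φ t :=
    (hs1.continuous_deriv le_rfl).comp continuous_subtype_val
  have hφ1 : φ 1 = 0 := by
    by_contra h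
    exact lt_irrefl _ (ht (subset_tsupport φ h)).2
  -- Tested against `y`, with `z` the adjoint of `Λ` applied to `y`, the process becomes `⟪y, B t⟫ =
  -- ∫ x in [0,t], z x`, and the claim is the scalar integration by parts.
  have hlim : Λ (hφ2.toLp _) = -∫ t : unitInterval, deriv φ t • (hB.memLp t).toLp (B t) := by
    have hi : Integrable fun t : unitInterval => deriv φ t • (hB.memLp t).toLp (B t) :=
      (hd.smul (hB.continuous_toLp hH)).integrable_of_hasCompactSupport
        (HasCompactSupport.of_compactSpace _)
    refine ext_inner_left ℝ fun y => ?_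
    rw [inner_neg_right, ← integral_inner hi, ← ContinuousLinearMap.adjoint_inner_left]
    set z := ContinuousLinearMap.adjoint Λ y with hz
    have h2 : ∀ t : unitInterval, inner ℝ y (deriv φ t • (hB.memLp t).toLp (B t)) =
        deriv φ t * ∫ x in Set.Icc 0 t, z x := fun t => by
      rw [inner_smul_right, ← hΛ, ← ContinuousLinearMap.adjoint_inner_left, real_inner_comm,
        L2.inner_indicatorConstLp_one]
    simp only [h2]
    rw [integral_deriv_mul_setIntegral hs1 hφ1 (integrable_Lp_two z), neg_neg, L2.inner_def]
    refine integral_congr_ae ?_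
    filter_upwards [hφ2.coeFn_toLp] with x hx
    rw [hx]
    simp [mul_comm]
  rw [← hlim]
  have h3 := (Λ.continuous.tendsto _).comp (R.tendsto_sum_smul_indLp hφc hφ2)
  refine h3.congr fun n => ?_
  simp only [Function.comp_apply, map_sum, map_smul]
  refine Finset.sum_congr rfl fun j _ => ?_
  rw [hMV, hV _ (R.measurableSet_part n j)]

end DistributionalDerivative

end

/-! ### The stochastic integral of `B` against its derivative -/

section

/-- Families of sequences in a Hilbert space whose mutual inner products all have the same double
limit converge to a common limit. -/
theorem exists_tendsto_of_tendsto_inner {E ι : Type*} [NormedAddCommGroup E]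
    [InnerProductSpace ℝ E] [CompleteSpace E] [Nonempty ι] {S : ι → ℕ → E} {q : ℝ}
    (h : ∀ r r', Tendsto (fun p : ℕ × ℕ => inner ℝ (S r p.1) (S r' p.2)) (atTop ×ˢ atTop) (𝓝 q)) :
    ∃ y, ∀ r, Tendsto (S r) atTop (𝓝 y) := by
  -- The squared distance tends to `q - 2q + q = 0`. The case `r = r'` gives the Cauchy property,
  -- general `r, r'` the common limit.
  have hd : ∀ r r', Tendsto (fun p : ℕ × ℕ => dist (S r p.1) (S r' p.2)) (atTop ×ˢ atTop)
      (𝓝 0) := by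
    intro r r'
    have hdiag : ∀ r, Tendsto (fun n => ‖S r n‖ ^ 2) atTop (𝓝 q) := fun r => by
      have := (h r r).comp (tendsto_id.prodMk tendsto_id)
      refine this.congr fun n => ?_
      simp
    have h1 : Tendsto (fun p : ℕ × ℕ => ‖S r p.1‖ ^ 2 - 2 * inner ℝ (S r p.1) (S r' p.2) +
        ‖S r' p.2‖ ^ 2) (atTop ×ˢ atTop) (𝓝 (q - 2 * q + q)) :=
      (((hdiag r).comp tendsto_fst).sub ((h r r').const_mul 2)).add ((hdiag r').comp tendsto_snd)
    have h2 := h1.sqrt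
    rw [show q - 2 * q + q = 0 by ring, Real.sqrt_zero] at h2
    refine h2.congr fun p => ?_
    rw [← norm_sub_sq_real, Real.sqrt_sq (norm_nonneg _), dist_eq_norm]
  obtain ⟨r₀⟩ := ‹Nonempty ι›
  have hc : CauchySeq (S r₀) := by
    rw [cauchySeq_iff_tendsto_dist_atTop_0, ← prod_atTop_atTop_eq]
    exact hd r₀ r₀
  obtain ⟨y, hy⟩ := cauchySeq_tendsto_of_complete hc
  refine ⟨y, fun r => ?_⟩
  have h3 : Tendsto (fun n => dist (S r₀ n) (S r n)) atTop (𝓝 0) :=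
    (hd r₀ r).comp (tendsto_id.prodMk tendsto_id)
  exact (tendsto_iff_of_dist h3).1 hy

section Density

variable {H : ℝ}

/-- The density of the second moment measure of `A ↦ ∫_A B dB'`. -/
noncomputable def secondMomentDensity (H : ℝ) (q : unitInterval × unitInterval) : ℝ :=
  crossDensity H (q.1, q.1) * crossDensity H (q.2, q.2) +
    crossDensity H (q.2, q.1) * crossDensity H (q.1, q.2) + covFun H q * covDensity H q

theorem secondMomentDensity_nonneg (hH : 1 / 2 < H) (q : unitInterval × unitInterval) :
    0 ≤ secondMomentDensity H q :=
  add_nonneg (add_nonneg (mul_nonneg (crossDensity_nonneg hH _) (crossDensity_nonneg hH _))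
    (mul_nonneg (crossDensity_nonneg hH _) (crossDensity_nonneg hH _)))
    (mul_nonneg (covFun_nonneg hH _) (covDensity_nonneg hH _))

theorem integrable_crossDensity_diag_mul (hH : 1 / 2 < H) :
    Integrable fun q : unitInterval × unitInterval =>
      crossDensity H (q.1, q.1) * crossDensity H (q.2, q.2) :=
  have hc := continuous_crossDensity hH
  integrable_of_continuous_of_compactSpace _ ((hc.comp (by fun_prop)).mul (hc.comp (by fun_prop)))

theorem integrable_crossDensity_swap_mul (hH : 1 / 2 < H) :
    Integrable fun q : unitInterval × unitInterval =>
      crossDensity H (q.2, q.1) * crossDensity H (q.1, q.2) :=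
  have hc := continuous_crossDensity hH
  integrable_of_continuous_of_compactSpace _ ((hc.comp (by fun_prop)).mul (hc.comp (by fun_prop)))

theorem integrable_covFun_mul_covDensity (hH : 1 / 2 < H) :
    Integrable fun q : unitInterval × unitInterval => covFun H q * covDensity H q := by
  obtain ⟨C, hC⟩ := isCompact_univ.exists_bound_of_continuousOn (continuous_covFun hH).continuousOn
  exact (integrable_covDensity hH).bdd_mul (c := C)
    (continuous_covFun hH).aestronglyMeasurable
    (Eventually.of_forall fun q => hC q (Set.mem_univ q))

theorem integrable_secondMomentDensity (hH : 1 / 2 < H) :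
    Integrable (secondMomentDensity H) :=
  ((integrable_crossDensity_diag_mul hH).add (integrable_crossDensity_swap_mul hH)).add
    (integrable_covFun_mul_covDensity hH)

/-- The covariance measure of fractional Brownian motion as a positive measure. -/
noncomputable def covMeasure (H : ℝ) : Measure (unitInterval × unitInterval) :=
  volume.withDensity fun q => ENNReal.ofReal (covDensity H q)

theorem isFiniteMeasure_covMeasure (hH : 1 / 2 < H) : IsFiniteMeasure (covMeasure H) :=
  isFiniteMeasure_withDensity_ofReal (integrable_covDensity hH).2

theorem setIntegral_covMeasure (hH : 1 / 2 < H) (f : unitInterval × unitInterval → ℝ)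
    {E : Set (unitInterval × unitInterval)} (hE : MeasurableSet E) :
    ∫ q in E, f q ∂covMeasure H = ∫ q in E, f q * covDensity H q := by
  rw [covMeasure, setIntegral_withDensity_eq_setIntegral_toReal_smul
    measurable_covDensity.ennreal_ofReal (Eventually.of_forall fun _ => ENNReal.ofReal_lt_top) _ hE]
  refine integral_congr_ae (Eventually.of_forall fun q => ?_)
  simp [ENNReal.toReal_ofReal (covDensity_nonneg hH q), mul_comm]

end Density

section StochasticIntegral

variable {Ω : Type*} [MeasurableSpace Ω] {P : Measure Ω} [IsProbabilityMeasure P] {H : ℝ}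
  {B : unitInterval → Ω → ℝ} {M : VectorMeasure unitInterval (Lp ℝ 2 P)}

theorem IsFractionalBrownianMotion.memLp_mul (hB : IsFractionalBrownianMotion H B P)
    (hM : ∀ t, M (Set.Icc 0 t) = (hB.memLp t).toLp (B t)) (t : unitInterval)
    (A : Set unitInterval) : MemLp (fun ω => B t ω * (M A : Ω → ℝ) ω) 2 P := by
  have := holderTriple_four_four_two
  have h1 := (hB.isCentredGaussian_of_mem (toLp_mem_closedSpan hB.memLp t)).memLp_four
  have h2 := (hB.isCentredGaussian_of_mem (apply_mem_closedSpan_of_primitive hM A)).memLp_four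
  exact h2.mul (h1.ae_eq (hB.memLp t).coeFn_toLp) (r := 2)

/-- The products `B t * M A` as elements of `L²(P)`. -/
noncomputable def mulLp (hB : IsFractionalBrownianMotion H B P)
    (hM : ∀ t, M (Set.Icc 0 t) = (hB.memLp t).toLp (B t)) (t : unitInterval)
    (A : Set unitInterval) : Lp ℝ 2 P :=
  (hB.memLp_mul hM t A).toLp _

/-- The Riemann sums of the stochastic integral as elements of `L²(P)`. -/
noncomputable def riemannSumLp (hB : IsFractionalBrownianMotion H B P)
    (hM : ∀ t, M (Set.Icc 0 t) = (hB.memLp t).toLp (B t)) {D : Set unitInterval}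
    (R : RiemannSystem D) (n : ℕ) : Lp ℝ 2 P :=
  ∑ j, mulLp hB hM (R.tag n j) (R.part n j)

theorem isStochIntegral_iff_tendsto_riemannSumLp (hB : IsFractionalBrownianMotion H B P)
    (hM : ∀ t, M (Set.Icc 0 t) = (hB.memLp t).toLp (B t)) {D : Set unitInterval} {Y : Lp ℝ 2 P} :
    IsStochIntegral 2 P B M D Y ↔
      ∀ R : RiemannSystem D, Tendsto (riemannSumLp hB hM R) atTop (𝓝 Y) := by
  refine forall_congr' fun R => tendsto_eLpNorm_sub_iff (fun n => ?_) Y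
  filter_upwards [Lp.coeFn_finsetSum Finset.univ fun j => mulLp hB hM (R.tag n j) (R.part n j),
    (Finset.eventually_all Finset.univ).2 fun j _ =>
      (hB.memLp_mul hM (R.tag n j) (R.part n j)).coeFn_toLp] with ω h h'
  rw [riemannSumLp, h, Finset.sum_apply]
  exact Finset.sum_congr rfl h'

/-- Isserlis' formula gives three pairings. The one with `⟪M A, M D⟫` is kept as an integral against
`covMeasure`, since `covDensity` is singular near the diagonal while the Riemann sum lemma needs a
continuous integrand. -/
theorem inner_mulLp_mulLp (hB : IsFractionalBrownianMotion H B P) (hH : 1 / 2 < H)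
    (hM : ∀ t, M (Set.Icc 0 t) = (hB.memLp t).toLp (B t)) (s t : unitInterval)
    {A D : Set unitInterval} (hA : MeasurableSet A) (hD : MeasurableSet D) :
    inner ℝ (mulLp hB hM s A) (mulLp hB hM t D) =
      (∫ q in A ×ˢ D, (crossDensity H (s, q.1) * crossDensity H (t, q.2) +
        crossDensity H (t, q.1) * crossDensity H (s, q.2))) +
      ∫ _ in A ×ˢ D, covFun H (s, t) ∂covMeasure H := by
  have hmem := toLp_mem_closedSpan hB.memLp
  have hmem' := apply_mem_closedSpan_of_primitive hM
  have h1 := integral_mul_mul_mul_of_gaussian (fun w hw => hB.isCentredGaussian_of_mem hw)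
    (hmem s) (hmem' A) (hmem t) (hmem' D)
  have h2 : inner ℝ (mulLp hB hM s A) (mulLp hB hM t D) = ∫ ω, (hB.memLp s).toLp (B s) ω * M A ω *
      ((hB.memLp t).toLp (B t) ω * M D ω) ∂P := by
    rw [L2.inner_def]
    refine integral_congr_ae ?_
    filter_upwards [(hB.memLp_mul hM s A).coeFn_toLp, (hB.memLp_mul hM t D).coeFn_toLp,
      (hB.memLp s).coeFn_toLp, (hB.memLp t).coeFn_toLp] with ω e1 e2 e3 e4
    rw [mulLp, mulLp, e1, e2, e3, e4]
    simp [mul_comm]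
  have hc := continuous_crossDensity hH
  have hi : ∀ x y : unitInterval, Integrable fun q : unitInterval × unitInterval =>
      crossDensity H (x, q.1) * crossDensity H (y, q.2) := fun x y =>
    integrable_of_continuous_of_compactSpace _ ((hc.comp (by fun_prop)).mul (hc.comp (by fun_prop)))
  have hp : ∀ x y : unitInterval, ∫ q in A ×ˢ D, crossDensity H (x, q.1) * crossDensity H (y, q.2) =
      (∫ u in A, crossDensity H (x, u)) * ∫ v in D, crossDensity H (y, v) := fun x y => by
    rw [Measure.volume_eq_prod]
    exact setIntegral_prod_mul (fun u => crossDensity H (x, u)) (fun v => crossDensity H (y, v)) A D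
  rw [h2, h1, integral_add (hi s t).integrableOn (hi t s).integrableOn, hp, hp,
    setIntegral_covMeasure hH _ (hA.prod hD), integral_const_mul, hB.inner_toLp_apply hH hM s hA,
    hB.inner_toLp_apply hH hM t hD, hB.inner_toLp, hB.inner_apply_apply hH hM hA hD,
    hB.inner_toLp_apply hH hM s hD, real_inner_comm, hB.inner_toLp_apply hH hM t hA]
  ring

theorem tendsto_inner_riemannSumLp (hB : IsFractionalBrownianMotion H B P) (hH : 1 / 2 < H)
    (hM : ∀ t, M (Set.Icc 0 t) = (hB.memLp t).toLp (B t)) {A D : Set unitInterval}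
    (hA : MeasurableSet A) (hD : MeasurableSet D) (R : RiemannSystem A) (S : RiemannSystem D) :
    Tendsto (fun p : ℕ × ℕ => inner ℝ (riemannSumLp hB hM R p.1) (riemannSumLp hB hM S p.2))
      (atTop ×ˢ atTop) (𝓝 (∫ q in A ×ˢ D, secondMomentDensity H q)) := by
  have := isFiniteMeasure_covMeasure hH
  have hc := continuous_crossDensity hH
  have h1 := R.tendsto_sum_sum_setIntegral S volume
    (G := fun x : (unitInterval × unitInterval) × (unitInterval × unitInterval) =>
      crossDensity H (x.1.1, x.2.1) * crossDensity H (x.1.2, x.2.2) +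
        crossDensity H (x.1.2, x.2.1) * crossDensity H (x.1.1, x.2.2))
    (((hc.comp (by fun_prop)).mul (hc.comp (by fun_prop))).add
      ((hc.comp (by fun_prop)).mul (hc.comp (by fun_prop))))
  have h2 := R.tendsto_sum_sum_setIntegral S (covMeasure H)
    (G := fun x : (unitInterval × unitInterval) × (unitInterval × unitInterval) =>
      covFun H x.1) ((continuous_covFun hH).comp continuous_fst)
  have h3 := h1.add h2
  have hlim : ∫ q in A ×ˢ D, secondMomentDensity H q =
      (∫ q in A ×ˢ D, (crossDensity H (q.1, q.1) * crossDensity H (q.2, q.2) +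
        crossDensity H (q.2, q.1) * crossDensity H (q.1, q.2))) +
      ∫ q in A ×ˢ D, covFun H q ∂covMeasure H := by
    rw [setIntegral_covMeasure hH _ (hA.prod hD)]
    exact integral_add ((integrable_crossDensity_diag_mul hH).add
      (integrable_crossDensity_swap_mul hH)).integrableOn
      (integrable_covFun_mul_covDensity hH).integrableOn
  rw [hlim]
  refine h3.congr fun p => ?_
  rw [riemannSumLp, riemannSumLp, sum_inner, ← Finset.sum_add_distrib]
  refine Finset.sum_congr rfl fun j _ => ?_
  rw [inner_sum, ← Finset.sum_add_distrib]
  refine Finset.sum_congr rfl fun k _ => ?_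
  rw [inner_mulLp_mulLp hB hH hM _ _ (R.measurableSet_part _ _) (S.measurableSet_part _ _)]

theorem exists_isStochIntegral (hB : IsFractionalBrownianMotion H B P) (hH : 1 / 2 < H)
    (hM : ∀ t, M (Set.Icc 0 t) = (hB.memLp t).toLp (B t)) {D : Set unitInterval}
    (hD : MeasurableSet D) : ∃ Y, IsStochIntegral 2 P B M D Y := by
  have := nonempty_riemannSystem hD
  obtain ⟨Y, hY⟩ := exists_tendsto_of_tendsto_inner
    fun R S : RiemannSystem D => tendsto_inner_riemannSumLp hB hH hM hD hD R S
  exact ⟨Y, (isStochIntegral_iff_tendsto_riemannSumLp hB hM).2 hY⟩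

theorem IsStochIntegral.eq (hB : IsFractionalBrownianMotion H B P)
    (hM : ∀ t, M (Set.Icc 0 t) = (hB.memLp t).toLp (B t)) {D : Set unitInterval}
    (hD : MeasurableSet D) {Y Y' : Lp ℝ 2 P} (h : IsStochIntegral 2 P B M D Y)
    (h' : IsStochIntegral 2 P B M D Y') : Y = Y' := by
  obtain ⟨R⟩ := nonempty_riemannSystem hD
  exact tendsto_nhds_unique ((isStochIntegral_iff_tendsto_riemannSumLp hB hM).1 h R)
    ((isStochIntegral_iff_tendsto_riemannSumLp hB hM).1 h' R)

theorem IsStochIntegral.inner_eq (hB : IsFractionalBrownianMotion H B P) (hH : 1 / 2 < H)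
    (hM : ∀ t, M (Set.Icc 0 t) = (hB.memLp t).toLp (B t)) {A D : Set unitInterval}
    (hA : MeasurableSet A) (hD : MeasurableSet D) {Y Y' : Lp ℝ 2 P}
    (h : IsStochIntegral 2 P B M A Y) (h' : IsStochIntegral 2 P B M D Y') :
    inner ℝ Y Y' = ∫ q in A ×ˢ D, secondMomentDensity H q := by
  obtain ⟨R⟩ := nonempty_riemannSystem hA
  obtain ⟨S⟩ := nonempty_riemannSystem hD
  refine tendsto_nhds_unique (Tendsto.inner (𝕜 := ℝ)
    (((isStochIntegral_iff_tendsto_riemannSumLp hB hM).1 h R).comp tendsto_fst)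
    (((isStochIntegral_iff_tendsto_riemannSumLp hB hM).1 h' S).comp tendsto_snd))
    (tendsto_inner_riemannSumLp hB hH hM hA hD R S)

/-- Expectations of the Riemann sums are the self-integral sums of the cross-covariance kernel, and
expectation, as the inner product with `1`, is continuous on `L²(P)`. -/
theorem IsStochIntegral.integral_eq (hB : IsFractionalBrownianMotion H B P) (hH : 1 / 2 < H)
    (hM : ∀ t, M (Set.Icc 0 t) = (hB.memLp t).toLp (B t)) {A : Set unitInterval}
    (hA : MeasurableSet A) {Y : Lp ℝ 2 P} (h : IsStochIntegral 2 P B M A Y) :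
    ∫ ω, Y ω ∂P = ∫ u in A, crossDensity H (u, u) := by
  obtain ⟨R⟩ := nonempty_riemannSystem hA
  let one : Lp ℝ 2 P := indicatorConstLp 2 MeasurableSet.univ (measure_ne_top P _) 1
  have hone : ∀ w : Lp ℝ 2 P, inner ℝ one w = ∫ ω, w ω ∂P := fun w => by
    rw [L2.inner_indicatorConstLp_one, setIntegral_univ]
  have h1 := (tendsto_const_nhds (x := one)).inner (𝕜 := ℝ)
    ((isStochIntegral_iff_tendsto_riemannSumLp hB hM).1 h R)
  rw [hone] at h1
  refine tendsto_nhds_unique h1 ?_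
  have h2 := isSelfIntegral_of_density hH (fun t A hA => hB.crossCovKernel_eq hH hM t hA) A R
  refine h2.congr fun n => ?_
  rw [riemannSumLp, inner_sum]
  refine Finset.sum_congr rfl fun j _ => ?_
  rw [hone, crossCovKernel_apply, covariance_eq_sub (hB.memLp _) (Lp.memLp _), hB.centred, zero_mul,
    sub_zero]
  exact (integral_congr_ae (hB.memLp_mul hM _ _).coeFn_toLp).symm

/-- The integrals have a Gram measure with nonnegative integrable density, whence σ-additivity.
Subtracting the product of the means, which also has a density, turns it into the covariance
measure. -/
theorem exists_vectorMeasure_isStochIntegral (hB : IsFractionalBrownianMotion H B P)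
    (hH : 1 / 2 < H) (hM : ∀ t, M (Set.Icc 0 t) = (hB.memLp t).toLp (B t)) :
    ∃ N : VectorMeasure unitInterval (Lp ℝ 2 P),
      IsRandomMeasure P N ∧ ∀ A, MeasurableSet A → IsStochIntegral 2 P B M A (N A) := by
  classical
  choose Y hY using fun (D : Set unitInterval) (hD : MeasurableSet D) =>
    exists_isStochIntegral hB hH hM hD
  have hi := integrable_secondMomentDensity hH
  let ρ : Measure (unitInterval × unitInterval) :=
    volume.withDensity fun q => ENNReal.ofReal (secondMomentDensity H q)
  have : IsFiniteMeasure ρ := isFiniteMeasure_withDensity_ofReal hi.2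
  obtain ⟨N, hN⟩ := exists_vectorMeasure_of_inner
    (N := fun D => if hD : MeasurableSet D then Y D hD else 0) (ρ := ρ) (fun A D hA hD => by
      simp only [hA, hD, dif_pos]
      rw [(hY A hA).inner_eq hB hH hM hA hD (hY D hD), measureReal_def,
        withDensity_apply _ (hA.prod hD), integral_eq_lintegral_of_nonneg_ae
          (Eventually.of_forall fun q => secondMomentDensity_nonneg hH q)
          hi.integrableOn.aestronglyMeasurable])
  have hNI : ∀ A, MeasurableSet A → IsStochIntegral 2 P B M A (N A) := fun A hA => by
    rw [hN A hA, dif_pos hA]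
    exact hY A hA
  refine ⟨N, ⟨volume.withDensityᵥ fun q => secondMomentDensity H q -
    crossDensity H (q.1, q.1) * crossDensity H (q.2, q.2), fun A D hA hD => ?_⟩, hNI⟩
  have hsub : Integrable fun q => secondMomentDensity H q -
      crossDensity H (q.1, q.1) * crossDensity H (q.2, q.2) :=
    hi.sub (integrable_crossDensity_diag_mul hH)
  rw [withDensityᵥ_apply hsub (hA.prod hD),
    integral_sub hi.integrableOn (integrable_crossDensity_diag_mul hH).integrableOn,
    covariance_eq_inner, (hNI A hA).inner_eq hB hH hM hA hD (hNI D hD),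
    (hNI A hA).integral_eq hB hH hM hA, (hNI D hD).integral_eq hB hH hM hD]
  congr 1
  rw [Measure.volume_eq_prod]
  exact setIntegral_prod_mul (fun u => crossDensity H (u, u)) (fun v => crossDensity H (v, v)) A D

end StochasticIntegral

end

end SelfIntegral

/-! ### The main theorem -/

theorem mainTheorem8 {Ω : Type*} [MeasurableSpace Ω] (P : Measure Ω) [IsProbabilityMeasure P]
    (H : ℝ) (hH : 1 / 2 < H) (hH1 : H < 1) (B : unitInterval → Ω → ℝ)
    (hB : SelfIntegral.IsFractionalBrownianMotion H B P) :
    -- the derivative random measure of `B` exists and is unique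
    (∃! M : VectorMeasure unitInterval (Lp ℝ 2 P),
      SelfIntegral.IsDerivativeRandomMeasure P B hB.memLp M) ∧
    ∀ M : VectorMeasure unitInterval (Lp ℝ 2 P),
      SelfIntegral.IsDerivativeRandomMeasure P B hB.memLp M →
      -- `M` is centred, has primitive `B`, and has the stated covariance measure
      (∀ A, MeasurableSet A → ∫ ω, M A ω ∂P = 0) ∧
      (∀ t : unitInterval, M (Set.Icc 0 t) =ᵐ[P] B t) ∧
      Integrable (fun q : unitInterval × unitInterval =>
        |(q.1 : ℝ) - q.2| ^ (2 * H - 2)) ∧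
      (∃ C : SignedMeasure (unitInterval × unitInterval),
        SelfIntegral.IsCovarianceMeasure P M C ∧
        ∀ E, MeasurableSet E →
          C E = H * (2 * H - 1) * ∫ q in E, |(q.1 : ℝ) - q.2| ^ (2 * H - 2)) ∧
      -- the cross-covariance kernel and its second-order kernel
      (∀ (t : unitInterval) (A : Set unitInterval), MeasurableSet A →
        SelfIntegral.crossCovKernel P B hB.memLp M t A =
          H * ∫ u in A, ((u : ℝ) ^ (2 * H - 1) +
            |(t : ℝ) - u| ^ (2 * H - 1) * Real.sign ((t : ℝ) - u))) ∧
      (∀ (t : unitInterval) (A : Set unitInterval), MeasurableSet A →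
        0 ≤ SelfIntegral.crossCovKernel P B hB.memLp M t A) ∧
      SelfIntegral.IsCfmKernel (SelfIntegral.crossCovKernel P B hB.memLp M) ∧
      SelfIntegral.IsCfmKernel
        (SelfIntegral.secondOrderKernel (SelfIntegral.crossCovKernel P B hB.memLp M)) ∧
      -- the self-integral
      SelfIntegral.SelfIntegrable (SelfIntegral.crossCovKernel P B hB.memLp M) Set.univ ∧
      SelfIntegral.IsSelfIntegral (SelfIntegral.crossCovKernel P B hB.memLp M) Set.univ (1 / 2) ∧
      -- the quasi-self-integral
      SelfIntegral.QuasiSelfIntegrable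
        (SelfIntegral.secondOrderKernel (SelfIntegral.crossCovKernel P B hB.memLp M))
        Set.univ Set.univ ∧
      SelfIntegral.IsQuasiSelfIntegral
        (SelfIntegral.secondOrderKernel (SelfIntegral.crossCovKernel P B hB.memLp M))
        Set.univ Set.univ
        (1 / 2 - H * ProbabilityTheory.beta (2 * H) (2 * H + 1) - H / (2 * (4 * H - 1))) ∧
      -- the stochastic integrals of `B` with respect to `M`
      (∀ A, MeasurableSet A → SelfIntegral.StochIntegralUniquelyDefined 2 P B M A) ∧
      (∃! N : VectorMeasure unitInterval (Lp ℝ 2 P),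
        SelfIntegral.IsRandomMeasure P N ∧
        ∀ A, MeasurableSet A → SelfIntegral.IsStochIntegral 2 P B M A (N A)) := by
  obtain ⟨M₀, hM₀, hprim⟩ := hB.exists_isDerivativeRandomMeasure hH
  refine ⟨⟨M₀, hM₀, fun M hM => hM.eq hM₀⟩, fun M hM => ?_⟩
  -- By uniqueness every derivative random measure is the constructed one, so `hprim`, on which
  -- everything below rests, holds for it.
  obtain rfl : M = M₀ := hM.eq hM₀
  have hK := fun t A hA => hB.crossCovKernel_eq hH hprim t (A := A) hA
  have hself : SelfIntegral.IsSelfIntegral (SelfIntegral.crossCovKernel P B hB.memLp M)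
      Set.univ (1 / 2) := by
    have h := SelfIntegral.isSelfIntegral_of_density hH hK Set.univ
    rwa [setIntegral_univ, SelfIntegral.integral_crossDensity_diag hH] at h
  have hquasi : SelfIntegral.IsQuasiSelfIntegral
      (SelfIntegral.secondOrderKernel (SelfIntegral.crossCovKernel P B hB.memLp M))
      Set.univ Set.univ
      (1 / 2 - H * ProbabilityTheory.beta (2 * H) (2 * H + 1) - H / (2 * (4 * H - 1))) := by
    have h := SelfIntegral.isQuasiSelfIntegral_of_density hH hK Set.univ Set.univ
    rwa [Set.univ_prod_univ, setIntegral_univ,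
      SelfIntegral.integral_crossDensity_mul_swap hH] at h
  have hc : H * (2 * H - 1) ≠ 0 := (mul_pos (by linarith) (by linarith)).ne'
  obtain ⟨N, hN, hNI⟩ := SelfIntegral.exists_vectorMeasure_isStochIntegral hB hH hprim
  refine ⟨fun A _ => hB.integral_apply hprim A, fun t => ?_, ?_,
    ⟨_, SelfIntegral.isCovarianceMeasure_withDensity hB hH hprim, fun E hE => ?_⟩,
    fun t A hA => ?_, fun t A hA => ?_, SelfIntegral.isCfmKernel_of_density hH hK,
    SelfIntegral.isCfmKernel_secondOrderKernel_of_density hH hK,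
    hself.selfIntegrable .univ, hself, hquasi.quasiSelfIntegrable .univ .univ, hquasi,
    fun A hA => ?_, ⟨N, ⟨hN, hNI⟩, fun N' hN' => ?_⟩⟩
  · rw [hprim]
    exact (hB.memLp t).coeFn_toLp
  · exact ((SelfIntegral.integrable_covDensity hH).const_mul (H * (2 * H - 1))⁻¹).congr
      (Eventually.of_forall fun q => inv_mul_cancel_left₀ hc _)
  · rw [withDensityᵥ_apply (SelfIntegral.integrable_covDensity hH) hE, ← integral_const_mul]
    rfl
  · rw [hK t A hA, ← integral_const_mul]
    rfl
  · rw [hK t A hA]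
    exact integral_nonneg fun u => SelfIntegral.crossDensity_nonneg hH _
  · obtain ⟨Y, hY⟩ := SelfIntegral.exists_isStochIntegral hB hH hprim hA
    exact ⟨Y, hY, fun Y' hY' => SelfIntegral.IsStochIntegral.eq hB hprim hA hY' hY⟩
  · exact VectorMeasure.ext fun A hA =>
      SelfIntegral.IsStochIntegral.eq hB hprim hA (hN'.2 A hA) (hNI A hA)
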